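/- **Setting.** A contest with $n\ge 1$ players is a vector $\mathbf n=(n_1,\dots,n_T)$ of positive integers with $\sum_t n_t=n$: the first $n_1$ players move simultaneously in period 1, the next $n_2$ in period 2, and so on. A player of period $t$ observes the cumulative effort of all players of earlier periods and then chooses an effort $x_i\ge 0$; the payoff is $u_i(\mathbf x)=x_i\,h(X)$ with $X=\sum_j x_j$. The equilibrium concept is subgame-perfect Nash equilibrium, and $X^*$ is the total equilibrium effort. Standing assumptions for $n$ players: $\overline X>0$; $h$ is $n+1$ times continuously differentiable on $[0,\overline X]$ with $h'<0$ there, $h(\overline X)=0$, and $h(X)<0$ for $X>\overline X$. Let $g_1=g=-h/h'$ and $g_{k+1}=-g_k'\,g$ on $[0,\overline X]$. For a contest $\mathbf n$ let $S_k(\mathbf n^t)$ be the sum of the products of all $k$-combinations of $n_{t+1},\dots,n_T$, and $f_t(X)=X-\sum_{k=1}^{T-t}S_k(\mathbf n^t)g_k(X)$. For every $n$-player contest: (A1) putting $\underline X_T=0$, for $t=T-1,\dots,0$ the function $f_t$ has a root in $[\underline X_{t+1},\overline X]$, with highest such root $\underline X_t$; $f_t<0$ on $[\underline X_{t+1},\underline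 X_t)$; $f_t'>0$ on $[\underline X_t,\overline X]$; and $\underline X_0\in(0,\overline X)$; (A2) $g_k(X^*)>0$ for $k=2,\dots,T$. **Proposition (Highest Effort).** Under the standing assumptions for $n$ players, every $n$-player contest has a unique equilibrium effort profile $\mathbf x^*$, and its highest effort $\max_i x_i^*$ equals $x_1^*$. Moreover, among all $n$-player contests: 1. the highest effort is minimized by the simultaneous contest $(n)$, and by no other contest; 2. if $\mathbf n$ maximizes the highest effort, then $n_1=1$; 3. if $h$ is linear (affine) on $[0,\overline X]$, then every single-leader contest ($n_1=1$) maximizes the highest effort. Suppose now that for a fixed $h$ and $\overline X$ the standing assumptions hold for all sufficiently large $n$. 4. For every $T$ and every $\varepsilon>0$ there is $N$ such that for all $n\ge N$, the highest effort of any single-leader $n$-player contest with at most $T$ periods is within $\varepsilon$ of the maximum over all $n$-player contests with at most $T$ periods. 5. If moreover $h$ is real-analytic at $\overline X$ (given by a convergent power series on a left neighbourhood of $\overline X$), then for every $\varepsilon>0$ there is $N$ such that for all $n\ge N$, the highest effort of any single-leader $n$-player contest is within $\varepsilon$ of the maximum over all $n$-player contests. -/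

import Mathlib

open Set

/-! ## The game

A contest with `n` players is a composition `c` of `n`: the `t`-th block is the number of players
who arrive in period `t` (periods are numbered `0, …, c.length - 1`), and `c.index i` is the period
in which player `i` arrives. A strategy profile `σ` assigns to player `i` an effort `σ i y` for
every cumulative effort `y` of the earlier periods that the player may observe. -/

/-- Cumulative effort before period `s` when the players of the periods `≥ t` follow `σ` and the
cumulative effort before period `t` is `y`. -/
noncomputable def cumEffort {n : ℕ} (c : Composition n) (σ : Fin n → ℝ → ℝ) (t : ℕ) (y : ℝ) :
    ℕ → ℝ
  | 0 => y
  | s + 1 =>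
      if s < t then y
      else cumEffort c σ t y s +
        ∑ i : Fin n with (c.index i : ℕ) = s, σ i (cumEffort c σ t y s)

/-- Effort that player `i` (arriving in a period `≥ t`) exerts in the subgame that starts before
period `t` with cumulative effort `y`. -/
noncomputable def effortFrom {n : ℕ} (c : Composition n) (σ : Fin n → ℝ → ℝ) (t : ℕ) (y : ℝ)
    (i : Fin n) : ℝ :=
  σ i (cumEffort c σ t y (c.index i))

/-- Payoff `x_i h(X)` of player `i` in that subgame; `X` is the total effort of all players. -/
noncomputable def payoffFrom (h : ℝ → ℝ) {n : ℕ} (c : Composition n) (σ : Fin n → ℝ → ℝ)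
    (t : ℕ) (y : ℝ) (i : Fin n) : ℝ :=
  effortFrom c σ t y i * h (cumEffort c σ t y c.length)

/-- An admissible (nonnegative) strategy of a single player. -/
def IsStrategy (τ : ℝ → ℝ) : Prop := ∀ y, 0 ≤ y → 0 ≤ τ y

/-- Subgame-perfect Nash equilibrium: in every subgame (period `t`, cumulative effort `y ≥ 0`, which
is `0` at the start of the game) no player who is still to move gains by changing strategy. -/
def IsSPNE (h : ℝ → ℝ) {n : ℕ} (c : Composition n) (σ : Fin n → ℝ → ℝ) : Prop :=
  (∀ i, IsStrategy (σ i)) ∧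
    ∀ t < c.length, ∀ y : ℝ, 0 ≤ y → (t = 0 → y = 0) →
      ∀ i : Fin n, t ≤ (c.index i : ℕ) → ∀ τ : ℝ → ℝ, IsStrategy τ →
        payoffFrom h c (Function.update σ i τ) t y i ≤ payoffFrom h c σ t y i

/-- `x` is the effort profile on the path of some subgame-perfect Nash equilibrium. -/
def IsEquilibriumProfile (h : ℝ → ℝ) {n : ℕ} (c : Composition n) (x : Fin n → ℝ) : Prop :=
  ∃ σ, IsSPNE h c σ ∧ ∀ i, x i = effortFrom c σ 0 0 i

/-! ## Technical assumptions -/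

/-- `g = - h / h'` on `[0, Xbar]` (one-sided derivatives at the end points). -/
noncomputable def gFun (h : ℝ → ℝ) (Xbar : ℝ) (X : ℝ) : ℝ :=
  - h X / derivWithin h (Icc 0 Xbar) X

/-- `gTerm h Xbar k` is the function `g_{k+1}`: `g_1 = g` and `g_{k+1} = - g_k' g`. -/
noncomputable def gTerm (h : ℝ → ℝ) (Xbar : ℝ) : ℕ → ℝ → ℝ
  | 0 => gFun h Xbar
  | k + 1 => fun X => - derivWithin (gTerm h Xbar k) (Icc 0 Xbar) X * gFun h Xbar X

/-- `S_k` of the subcontest `(n_{t+1}, …, n_T)` that remains after the first `t` periods: the sum of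
the products of all `k`-combinations of the numbers `n_{t+1}, …, n_T`. -/
def infoMeasure {n : ℕ} (c : Composition n) (t k : ℕ) : ℕ :=
  Multiset.esymm (c.blocks.drop t : Multiset ℕ) k

/-- The inverted best-response function `f_t(X) = X - ∑_{k=1}^{T-t} S_k g_k(X)`. -/
noncomputable def invBestResponse (h : ℝ → ℝ) (Xbar : ℝ) {n : ℕ} (c : Composition n) (t : ℕ)
    (X : ℝ) : ℝ :=
  X - ∑ k ∈ Finset.range (c.length - t), (infoMeasure c t (k + 1) : ℝ) * gTerm h Xbar k X

/-- Well-behaved inverted best responses; `r t` is the highest root of `f_t` in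
`[r (t + 1), Xbar]`, where `r T = 0`. -/
def WellBehavedResponses (h : ℝ → ℝ) (Xbar : ℝ) {n : ℕ} (c : Composition n) : Prop :=
  ∃ r : ℕ → ℝ, r c.length = 0 ∧
    (∀ t < c.length,
      IsGreatest {X | X ∈ Icc (r (t + 1)) Xbar ∧ invBestResponse h Xbar c t X = 0} (r t) ∧
      (∀ X ∈ Ico (r (t + 1)) (r t), invBestResponse h Xbar c t X < 0) ∧
      (∀ X ∈ Icc (r t) Xbar, 0 < derivWithin (invBestResponse h Xbar c t) (Icc 0 Xbar) X)) ∧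
    r 0 ∈ Ioo 0 Xbar

/-- Higher-order strategic substitutes: `g_k(X*) > 0` for `k = 2, …, T`, where `X*` is the total
equilibrium effort. -/
def HigherOrderSubstitutes (h : ℝ → ℝ) (Xbar : ℝ) {n : ℕ} (c : Composition n) : Prop :=
  ∀ x, IsEquilibriumProfile h c x → ∀ k, 2 ≤ k → k ≤ c.length →
    0 < gTerm h Xbar (k - 1) (∑ i, x i)

/-- The standing assumptions on the marginal benefit function `h` with saturation point `Xbar` for
contests with `n` players. -/
structure StandingAssumptions (h : ℝ → ℝ) (Xbar : ℝ) (n : ℕ) : Prop where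
  saturation_pos : 0 < Xbar
  /-- so many derivatives are needed for `g_1, …, g_n` and `f_t'` to be defined -/
  contDiff : ContDiffOn ℝ ((n + 1 : ℕ) : WithTop ℕ∞) h (Icc 0 Xbar)
  /-- `h` is strictly decreasing and `g` is defined -/
  deriv_neg : ∀ X ∈ Icc 0 Xbar, derivWithin h (Icc 0 Xbar) X < 0
  saturation : h Xbar = 0
  /-- effort beyond saturation is harmful -/
  neg_beyond : ∀ X, Xbar < X → h X < 0
  wellBehaved : ∀ c : Composition n, WellBehavedResponses h Xbar c
  substitutes : ∀ c : Composition n, HigherOrderSubstitutes h Xbar c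

/-! ## The designer's objective -/

/-- `m` is the highest equilibrium effort `max_i x_i*` of the contest `c`. -/
def IsHighestEffort (h : ℝ → ℝ) {n : ℕ} (c : Composition n) (m : ℝ) : Prop :=
  ∃ x, IsEquilibriumProfile h c x ∧ IsGreatest (range x) m

/-- `c` maximizes the highest equilibrium effort among all contests with `n` players. -/
def MaximizesHighestEffort (h : ℝ → ℝ) {n : ℕ} (c : Composition n) : Prop :=
  ∃ m, IsHighestEffort h c m ∧ ∀ (c' : Composition n) (m' : ℝ), IsHighestEffort h c' m' → m' ≤ m

/-- `c` minimizes the highest equilibrium effort among all contests with `n` players. -/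
def MinimizesHighestEffort (h : ℝ → ℝ) {n : ℕ} (c : Composition n) : Prop :=
  ∃ m, IsHighestEffort h c m ∧ ∀ (c' : Composition n) (m' : ℝ), IsHighestEffort h c' m' → m ≤ m'

/-- The contest has a single leader, `n_1 = 1`. -/
def IsSingleLeader {n : ℕ} (c : Composition n) : Prop := c.blocks.head? = some 1

/-! # Highest efforts in sequential contests -/

/-! Equilibrium. Write `resp L` for the inverted best response before periods with block sizes `L`,
and `eff L` for `(resp L)' * g`. A player who faces `z` and is followed by `L` in effect chooses the
total `X`, with payoff `(resp L X - z) * h X`; the first-order condition is `resp L X - z = eff L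
X`. With `a` simultaneous movers this becomes `resp (a :: L) = resp L - a * eff L`, which is the
recursion satisfied by `f_t`. Single-peakedness (`payoff_lt`), uniqueness within a period
(`stage_unique`) and backward induction give a unique path: the total is the highest root of `f_0`,
and a player followed by `L` exerts `eff L` there.

Comparisons. All `g_k` are positive at the equilibrium total, so `eff` grows with the number of
later periods and the first player exerts most. The simultaneous contest has the lowest total and
shares it equally, so it has the lowest maximum. Detaching one leader from the first period raises
the total (`resp_split`); the highest effort before and after is the same increasing function of the
total, so it rises too (`leadEffort_split`).

Single leaders. The leader's effort `x` and the total `X` satisfy `2x - X = g + ∑ S_k (g_{k+1} -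
g_k)` at `X` (`two_mul_leadEffort_sub`). For linear `h` every `g_k` is `Xbar - X`, so `x = Xbar /
2`. For large `n` the total approaches `Xbar`, where every `g_k` has slope `-1`; with boundedly many
periods the differences are uniformly small relative to `g_k`, so `x` is near `Xbar / 2`.

Analytic `h`. In the variable `u = h X` the operator `-g d/dX` is `u d/du`. If `X = ∑ b_j u^j`, then
prepending a period of size `m` multiplies `b_j` by `1 + j m` (`resp_eq_tsum`). With `P = ∏ (1 +
n_t)`, the terms with `j ≥ 2` are negligible at scale `u ~ 1 / P`, uniformly in the contest
(`abs_series_sub_le`). So the root satisfies `Xbar + P b_1 u ≈ 0`. Removing a single leader halves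
`P`, hence `x ≈ Xbar + (P / 2) b_1 u ≈ Xbar / 2`. -/

namespace Contest

variable {h : ℝ → ℝ} {Xbar : ℝ} {n : ℕ}

/-! ## Inverted best responses indexed by lists of block sizes -/

/-- The sum of the products of all `k`-combinations of the members of `L`. -/
def esym (L : List ℕ) (k : ℕ) : ℕ := Multiset.esymm (L : Multiset ℕ) k

theorem esym_cons (a : ℕ) (L : List ℕ) (k : ℕ) :
    esym (a :: L) (k + 1) = esym L (k + 1) + a * esym L k := by
  rw [esym, ← Multiset.cons_coe, Multiset.esymm, Multiset.powersetCard_cons, Multiset.map_add,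
    Multiset.sum_add, Multiset.map_map]
  simp only [Function.comp_def, Multiset.prod_cons, Multiset.sum_map_mul_left]
  rfl

@[simp] theorem esym_zero (L : List ℕ) : esym L 0 = 1 := by
  simp [esym, Multiset.esymm]

theorem esym_length_succ (L : List ℕ) : esym L (L.length + 1) = 0 := by
  rw [esym, Multiset.esymm, Multiset.powersetCard_eq_empty _ (by simp)]; rfl

/-- The inverted best response before the periods with block sizes `L`. -/
noncomputable def resp (h : ℝ → ℝ) (Xbar : ℝ) (L : List ℕ) (X : ℝ) : ℝ :=
  X - ∑ k ∈ Finset.range L.length,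
    (esym L (k + 1) : ℝ) * gTerm h Xbar k X

/-- The effort of a player who is followed by periods with block sizes `L`, in terms of the
total effort `X`. -/
noncomputable def eff (h : ℝ → ℝ) (Xbar : ℝ) (L : List ℕ) (X : ℝ) : ℝ :=
  ∑ k ∈ Finset.range (L.length + 1), (esym L k : ℝ) * gTerm h Xbar k X

theorem invBestResponse_eq (h : ℝ → ℝ) (Xbar : ℝ) {n : ℕ} (c : Composition n) (t : ℕ) :
    invBestResponse h Xbar c t = resp h Xbar (c.blocks.drop t) := by
  funext X
  simp only [invBestResponse, resp, infoMeasure, esym, List.length_drop, c.blocks_length]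

@[simp] theorem resp_nil (h : ℝ → ℝ) (Xbar X : ℝ) : resp h Xbar [] X = X := by simp [resp]

@[simp] theorem eff_nil (h : ℝ → ℝ) (Xbar X : ℝ) : eff h Xbar [] X = gFun h Xbar X := by
  simp [eff, gTerm]

/-- Pascal's rule `S_k(a, L) = S_k(L) + a S_{k-1}(L)`; the top term of the extended sum vanishes
because `L` has no combination of `L.length + 1` members. -/
theorem resp_cons (h : ℝ → ℝ) (Xbar : ℝ) (a : ℕ) (L : List ℕ) (X : ℝ) :
    resp h Xbar (a :: L) X = resp h Xbar L X - a * eff h Xbar L X := by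
  have h0 := esym_length_succ L
  have h1 : ∑ k ∈ Finset.range L.length,
      (esym L (k + 1) : ℝ) * gTerm h Xbar k X =
      ∑ k ∈ Finset.range (L.length + 1),
      (esym L (k + 1) : ℝ) * gTerm h Xbar k X := by
    rw [Finset.sum_range_succ, h0]; simp
  rw [resp, resp, eff, h1, Finset.mul_sum, sub_sub, ← Finset.sum_add_distrib, List.length_cons]
  congr 1
  refine Finset.sum_congr rfl fun k _ => ?_
  rw [esym_cons]
  push_cast; ring

theorem eff_cons (h : ℝ → ℝ) (Xbar : ℝ) (a : ℕ) (L : List ℕ) (X : ℝ) :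
    eff h Xbar (a :: L) X = eff h Xbar L X + a * ∑ k ∈ Finset.range (L.length + 1),
      (esym L k : ℝ) * gTerm h Xbar (k + 1) X := by
  have h0 := esym_length_succ L
  have h1 : eff h Xbar L X = ∑ k ∈ Finset.range (L.length + 1 + 1),
      (esym L k : ℝ) * gTerm h Xbar k X := by
    rw [Finset.sum_range_succ, h0]; simp [eff]
  rw [h1, eff, List.length_cons, Finset.sum_range_succ', Finset.sum_range_succ' _ (L.length + 1),
    Finset.mul_sum, add_right_comm, ← Finset.sum_add_distrib]
  congr 1
  · refine Finset.sum_congr rfl fun k _ => ?_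
    rw [esym_cons]
    push_cast; ring
  · simp

/-- Splitting a block into two consecutive ones. -/
theorem resp_split (h : ℝ → ℝ) (Xbar : ℝ) (a b : ℕ) (L : List ℕ) (X : ℝ) :
    resp h Xbar (a :: b :: L) X = resp h Xbar ((a + b) :: L) X -
      a * b * ∑ k ∈ Finset.range (L.length + 1),
        (esym L k : ℝ) * gTerm h Xbar (k + 1) X := by
  rw [resp_cons, resp_cons, resp_cons, eff_cons]; push_cast; ring

/-! ## Consequences of the standing assumptions -/

theorem uniqueDiff (hS : StandingAssumptions h Xbar n) : UniqueDiffOn ℝ (Icc 0 Xbar) :=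
  uniqueDiffOn_Icc hS.saturation_pos

theorem contDiffOn_gTerm (hS : StandingAssumptions h Xbar n) {k m : ℕ} (hk : k + m ≤ n) :
    ContDiffOn ℝ (m : WithTop ℕ∞) (gTerm h Xbar k) (Icc 0 Xbar) := by
  have hg : ∀ m : ℕ, m ≤ n → ContDiffOn ℝ (m : WithTop ℕ∞) (gFun h Xbar) (Icc 0 Xbar) := by
    intro m hm
    have h1 : ContDiffOn ℝ (m : WithTop ℕ∞) h (Icc 0 Xbar) :=
      hS.contDiff.of_le (by exact_mod_cast (by omega : m ≤ n + 1))
    have h2 : ContDiffOn ℝ (m : WithTop ℕ∞) (derivWithin h (Icc 0 Xbar)) (Icc 0 Xbar) :=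
      hS.contDiff.derivWithin (uniqueDiff hS) (by exact_mod_cast (by omega : m + 1 ≤ n + 1))
    exact h1.neg.div h2 fun x hx => (hS.deriv_neg x hx).ne
  induction k generalizing m with
  | zero => exact hg m (by omega)
  | succ k ih =>
    have h1 : ContDiffOn ℝ ((m + 1 : ℕ) : WithTop ℕ∞) (gTerm h Xbar k) (Icc 0 Xbar) :=
      ih (by omega)
    exact ((h1.derivWithin (uniqueDiff hS) (by exact_mod_cast le_rfl)).neg).mul (hg m (by omega))

theorem hasDerivWithinAt_gTerm (hS : StandingAssumptions h Xbar n) {k : ℕ} (hk : k < n) {X : ℝ}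
    (hX : X ∈ Icc 0 Xbar) :
    HasDerivWithinAt (gTerm h Xbar k) (derivWithin (gTerm h Xbar k) (Icc 0 Xbar) X)
      (Icc 0 Xbar) X :=
  ((contDiffOn_gTerm hS (m := 1) (k := k) (by omega)).differentiableOn (by simp)
    X hX).hasDerivWithinAt

/-- Since `g_k' g = -g_{k+1}`, multiplying the derivative by `g` shifts every index by one. This
identity turns first-order conditions into the algebra of `eff`. -/
theorem hasDerivWithinAt_resp (hS : StandingAssumptions h Xbar n) {L : List ℕ}
    (hL : L.length ≤ n) {X : ℝ} (hX : X ∈ Icc 0 Xbar) :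
    HasDerivWithinAt (resp h Xbar L) (derivWithin (resp h Xbar L) (Icc 0 Xbar) X)
      (Icc 0 Xbar) X ∧
    derivWithin (resp h Xbar L) (Icc 0 Xbar) X * gFun h Xbar X = eff h Xbar L X := by
  have h1 : HasDerivWithinAt (resp h Xbar L) (1 - ∑ k ∈ Finset.range L.length,
      (esym L (k + 1) : ℝ) *
        derivWithin (gTerm h Xbar k) (Icc 0 Xbar) X) (Icc 0 Xbar) X := by
    refine (hasDerivWithinAt_id X _).sub ?_
    refine HasDerivWithinAt.fun_sum fun k hk => ?_
    exact (hasDerivWithinAt_gTerm hS ((Finset.mem_range.1 hk).trans_le hL) hX).const_mul _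
  have h2 := h1.derivWithin (uniqueDiff hS X hX)
  refine ⟨h2 ▸ h1, ?_⟩
  rw [h2, eff, Finset.sum_range_succ', sub_mul, Finset.sum_mul, sub_eq_add_neg, add_comm,
    ← Finset.sum_neg_distrib]
  congr 1
  · refine Finset.sum_congr rfl fun k _ => ?_
    simp only [gTerm]; ring
  · simp [gTerm]

theorem hasDerivWithinAt_h (hS : StandingAssumptions h Xbar n) {X : ℝ} (hX : X ∈ Icc 0 Xbar) :
    HasDerivWithinAt h (derivWithin h (Icc 0 Xbar) X) (Icc 0 Xbar) X :=
  (hS.contDiff.differentiableOn (by simp) X hX).hasDerivWithinAt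

/-- A function whose one-sided derivative on `[p, q] ⊆ [0, Xbar]` is positive inside is strictly
increasing there. -/
theorem strictMonoOn_of_derivWithin {f f' : ℝ → ℝ} {p q : ℝ} (hp : 0 ≤ p) (hq : q ≤ Xbar)
    (hf : ∀ X ∈ Icc 0 Xbar, HasDerivWithinAt f (f' X) (Icc 0 Xbar) X)
    (hpos : ∀ X ∈ Ioo p q, 0 < f' X) : StrictMonoOn f (Icc p q) := by
  have hsub : Icc p q ⊆ Icc 0 Xbar := Icc_subset_Icc hp hq
  refine strictMonoOn_of_hasDerivWithinAt_pos (convex_Icc p q) (f' := f')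
    (fun X hX => ((hf X (hsub hX)).mono hsub).continuousWithinAt) ?_ ?_
  · intro X hX
    exact (hf X (hsub (interior_subset hX))).mono (interior_subset.trans hsub)
  · intro X hX
    rw [interior_Icc] at hX
    exact hpos X hX

theorem strictAntiOn_h (hS : StandingAssumptions h Xbar n) : StrictAntiOn h (Icc 0 Xbar) := by
  have := strictMonoOn_of_derivWithin (Xbar := Xbar) (f := fun X => - h X) le_rfl le_rfl
    (fun X hX => (hasDerivWithinAt_h hS hX).neg)
    (fun X hX => neg_pos.2 (hS.deriv_neg X (Ioo_subset_Icc_self hX)))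
  intro x hx y hy hxy
  have := this hx hy hxy
  simpa using this

theorem h_pos (hS : StandingAssumptions h Xbar n) {X : ℝ} (hX : X ∈ Ico 0 Xbar) : 0 < h X := by
  rw [← hS.saturation]
  exact strictAntiOn_h hS (Ico_subset_Icc_self hX) (right_mem_Icc.2 hS.saturation_pos.le) hX.2

theorem gFun_pos (hS : StandingAssumptions h Xbar n) {X : ℝ} (hX : X ∈ Ico 0 Xbar) :
    0 < gFun h Xbar X := by
  rw [gFun, neg_div, neg_pos]
  exact div_neg_of_pos_of_neg (h_pos hS hX) (hS.deriv_neg X (Ico_subset_Icc_self hX))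

theorem gFun_Xbar (hS : StandingAssumptions h Xbar n) : gFun h Xbar Xbar = 0 := by
  simp [gFun, hS.saturation]

theorem gTerm_Xbar (hS : StandingAssumptions h Xbar n) (k : ℕ) : gTerm h Xbar k Xbar = 0 := by
  cases k <;> simp [gTerm, gFun_Xbar hS]

theorem resp_Xbar (hS : StandingAssumptions h Xbar n) (L : List ℕ) :
    resp h Xbar L Xbar = Xbar := by
  simp [resp, gTerm_Xbar hS]

/-! ### Tails of contests, highest roots and total effort -/

/-- The block sizes of the last periods of a contest with `n` players. -/
def IsTail (n : ℕ) (L : List ℕ) : Prop := (∀ a ∈ L, 0 < a) ∧ L.sum ≤ n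

theorem IsTail.of_cons {a : ℕ} {L : List ℕ} (hL : IsTail n (a :: L)) : IsTail n L :=
  ⟨fun b hb => hL.1 b (by simp [hb]), by have := hL.2; simp at this; omega⟩

theorem IsTail.length_le {L : List ℕ} (hL : IsTail n L) : L.length ≤ n :=
  (List.length_le_sum_of_one_le L fun i hi => hL.1 i hi).trans hL.2

theorem isTail_blocks (c : Composition n) : IsTail n c.blocks :=
  ⟨fun _ ha => c.blocks_pos ha, c.blocks_sum.le⟩

theorem IsTail.one_cons {a : ℕ} {L : List ℕ} (hL : IsTail n (a :: L)) : IsTail n (1 :: L) := by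
  have h1 := hL.2
  have h2 := hL.1 a (by simp)
  refine ⟨?_, ?_⟩
  · intro b hb
    rcases List.mem_cons.1 hb with rfl | hb
    · exact one_pos
    · exact hL.1 b (by simp [hb])
  · simp at h1 ⊢; omega

theorem isTail_drop (c : Composition n) (t : ℕ) : IsTail n (c.blocks.drop t) := by
  induction t with
  | zero => simpa using isTail_blocks c
  | succ t ih =>
    rw [← List.drop_drop]
    cases hd : c.blocks.drop t with
    | nil => exact ⟨by simp, by simp⟩
    | cons a L => rw [hd] at ih; simpa [Nat.add_comm] using ih.of_cons

/-- The highest root of the inverted best response. -/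
noncomputable def root (h : ℝ → ℝ) (Xbar : ℝ) : List ℕ → ℝ
  | [] => 0
  | a :: L => sSup {X | X ∈ Icc (root h Xbar L) Xbar ∧ resp h Xbar (a :: L) X = 0}

/-- The assumptions speak of contests, the induction of lists. Missing players are put into one
extra first period, so every tail inherits the assumptions. -/
theorem exists_composition {L : List ℕ} (hL : IsTail n L) :
    ∃ (c : Composition n) (t : ℕ), t + L.length = c.length ∧ c.blocks.drop t = L := by
  rcases hL.2.eq_or_lt with h1 | h1
  · refine ⟨⟨L, fun {i} hi => hL.1 i hi, h1⟩, 0, ?_, ?_⟩ <;> simp [Composition.length]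
  · refine ⟨⟨(n - L.sum) :: L, ?_, ?_⟩, 1, ?_, ?_⟩
    · intro i hi
      rcases List.mem_cons.1 hi with rfl | hi
      · omega
      · exact hL.1 i hi
    · simp; omega
    · simp [Composition.length, add_comm]
    · simp

theorem root_spec (hS : StandingAssumptions h Xbar n) (c : Composition n) :
    (∀ t < c.length,
      IsGreatest {X | X ∈ Icc (root h Xbar (c.blocks.drop (t + 1))) Xbar ∧
        resp h Xbar (c.blocks.drop t) X = 0} (root h Xbar (c.blocks.drop t)) ∧
      (∀ X ∈ Ico (root h Xbar (c.blocks.drop (t + 1))) (root h Xbar (c.blocks.drop t)),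
        resp h Xbar (c.blocks.drop t) X < 0) ∧
      (∀ X ∈ Icc (root h Xbar (c.blocks.drop t)) Xbar,
        0 < derivWithin (resp h Xbar (c.blocks.drop t)) (Icc 0 Xbar) X)) ∧
    root h Xbar c.blocks ∈ Ioo 0 Xbar := by
  obtain ⟨r, hr0, hr, hr1⟩ := hS.wellBehaved c
  simp only [invBestResponse_eq] at hr
  -- The recursion determines `r` backwards from `r T = 0`, so `r t` depends only on the remaining
  -- blocks and not on the contest.
  have key : ∀ t ≤ c.length, r t = root h Xbar (c.blocks.drop t) := by
    intro t ht
    induction ht using Nat.decreasingInduction with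
    | self => rw [hr0, ← c.blocks_length, List.drop_length]; rfl
    | of_succ t ht ih =>
      have hg := (hr t ht).1
      have hd : c.blocks.drop t = c.blocks[t]'(by simpa using ht) :: c.blocks.drop (t + 1) :=
        List.drop_eq_getElem_cons _
      rw [ih] at hg
      conv_rhs => rw [hd]
      rw [root, ← hd]
      exact hg.csSup_eq.symm
  refine ⟨fun t ht => ?_, ?_⟩
  · rw [← key t ht.le, ← key (t + 1) ht]
    exact hr t ht
  · have := key 0 (Nat.zero_le _)
    rw [List.drop_zero] at this
    rwa [← this]

theorem root_cons_spec (hS : StandingAssumptions h Xbar n) {a : ℕ} {L : List ℕ}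
    (hL : IsTail n (a :: L)) :
    IsGreatest {X | X ∈ Icc (root h Xbar L) Xbar ∧ resp h Xbar (a :: L) X = 0}
      (root h Xbar (a :: L)) ∧
    (∀ X ∈ Ico (root h Xbar L) (root h Xbar (a :: L)), resp h Xbar (a :: L) X < 0) ∧
    (∀ X ∈ Icc (root h Xbar (a :: L)) Xbar,
      0 < derivWithin (resp h Xbar (a :: L)) (Icc 0 Xbar) X) := by
  obtain ⟨c, t, ht, hd⟩ := exists_composition hL
  have h1 := (root_spec hS c).1 t (by simp at ht; omega)
  have h2 : c.blocks.drop (t + 1) = L := by rw [← List.drop_drop, hd]; rfl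
  rwa [h2, hd] at h1

theorem root_nonneg (hS : StandingAssumptions h Xbar n) {L : List ℕ} (hL : IsTail n L) :
    0 ≤ root h Xbar L := by
  induction L with
  | nil => exact le_rfl
  | cons a L ih => exact (ih hL.of_cons).trans (root_cons_spec hS hL).1.1.1.1

theorem root_le_root_cons (hS : StandingAssumptions h Xbar n) {a : ℕ} {L : List ℕ}
    (hL : IsTail n (a :: L)) : root h Xbar L ≤ root h Xbar (a :: L) :=
  (root_cons_spec hS hL).1.1.1.1

theorem resp_root (hS : StandingAssumptions h Xbar n) {L : List ℕ} (hL : IsTail n L) :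
    resp h Xbar L (root h Xbar L) = 0 := by
  cases L with
  | nil => simp [root]
  | cons a L => exact (root_cons_spec hS hL).1.1.2

theorem root_lt (hS : StandingAssumptions h Xbar n) {L : List ℕ} (hL : IsTail n L) :
    root h Xbar L < Xbar := by
  cases L with
  | nil => exact hS.saturation_pos
  | cons a L =>
    refine (root_cons_spec hS hL).1.1.1.2.lt_of_ne fun h1 => ?_
    have h2 := resp_root hS hL
    rw [h1, resp_Xbar hS] at h2
    exact hS.saturation_pos.ne' h2

theorem root_mem (hS : StandingAssumptions h Xbar n) {L : List ℕ} (hL : IsTail n L) :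
    root h Xbar L ∈ Ico 0 Xbar := ⟨root_nonneg hS hL, root_lt hS hL⟩

theorem resp_deriv_pos (hS : StandingAssumptions h Xbar n) {L : List ℕ} (hL : IsTail n L)
    {X : ℝ} (hX : X ∈ Icc (root h Xbar L) Xbar) :
    0 < derivWithin (resp h Xbar L) (Icc 0 Xbar) X := by
  cases L with
  | nil =>
    have h1 : resp h Xbar [] = id := by funext X; simp
    rw [h1, derivWithin_id _ _ (uniqueDiff hS X hX)]
    exact one_pos
  | cons a L => exact (root_cons_spec hS hL).2.2 X hX

theorem resp_strictMonoOn (hS : StandingAssumptions h Xbar n) {L : List ℕ} (hL : IsTail n L) :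
    StrictMonoOn (resp h Xbar L) (Icc (root h Xbar L) Xbar) :=
  strictMonoOn_of_derivWithin (root_nonneg hS hL) le_rfl
    (fun _ hX => (hasDerivWithinAt_resp hS hL.length_le hX).1)
    fun _ hX => resp_deriv_pos hS hL (Ioo_subset_Icc_self hX)

theorem eff_pos (hS : StandingAssumptions h Xbar n) {L : List ℕ} (hL : IsTail n L)
    {X : ℝ} (hX : X ∈ Ico (root h Xbar L) Xbar) : 0 < eff h Xbar L X := by
  have h0 : X ∈ Ico 0 Xbar := ⟨(root_nonneg hS hL).trans hX.1, hX.2⟩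
  rw [← (hasDerivWithinAt_resp hS hL.length_le (Ico_subset_Icc_self h0)).2]
  exact mul_pos (resp_deriv_pos hS hL (Ico_subset_Icc_self hX)) (gFun_pos hS h0)

/-- The inverted best response is negative between the two successive highest roots, so a
nonnegative value there places the point beyond the second one. -/
theorem root_cons_le (hS : StandingAssumptions h Xbar n) {a : ℕ} {L : List ℕ}
    (hL : IsTail n (a :: L)) {X : ℝ} (hX : root h Xbar L ≤ X)
    (h0 : 0 ≤ resp h Xbar (a :: L) X) : root h Xbar (a :: L) ≤ X := by
  by_contra! h1
  exact absurd ((root_cons_spec hS hL).2.1 X ⟨hX, h1⟩) (not_lt.2 h0)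

theorem le_root (hS : StandingAssumptions h Xbar n) {L : List ℕ} (hL : IsTail n L) {X : ℝ}
    (hX : X ≤ Xbar) (h0 : resp h Xbar L X ≤ 0) : X ≤ root h Xbar L := by
  by_contra! h1
  have := resp_strictMonoOn hS hL (left_mem_Icc.2 (root_lt hS hL).le) ⟨h1.le, hX⟩ h1
  rw [resp_root hS hL] at this
  exact absurd this (not_lt.2 h0)

/-- `total L y` is the total effort that results when the cumulative effort is `y` and periods with
block sizes `L` are still to come. -/
noncomputable def total (h : ℝ → ℝ) (Xbar : ℝ) (L : List ℕ) (y : ℝ) : ℝ :=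
  if y < Xbar then
    Function.invFunOn (resp h Xbar L) (Icc (root h Xbar L) Xbar) y
  else y

theorem total_of_le {L : List ℕ} {y : ℝ} (hy : Xbar ≤ y) : total h Xbar L y = y := by
  simp [total, not_lt.2 hy]

theorem total_spec (hS : StandingAssumptions h Xbar n) {L : List ℕ} (hL : IsTail n L) {y : ℝ}
    (hy : y ∈ Ico 0 Xbar) : total h Xbar L y ∈ Ico (root h Xbar L) Xbar ∧
      resp h Xbar L (total h Xbar L y) = y := by
  have hex : ∃ X ∈ Icc (root h Xbar L) Xbar, resp h Xbar L X = y := by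
    have hc : ContinuousOn (resp h Xbar L) (Icc (root h Xbar L) Xbar) := fun X hX =>
      ((hasDerivWithinAt_resp hS hL.length_le
        ⟨(root_nonneg hS hL).trans hX.1, hX.2⟩).1.continuousWithinAt).mono
        (Icc_subset_Icc (root_nonneg hS hL) le_rfl)
    have := intermediate_value_Icc (root_lt hS hL).le hc
    rw [resp_root hS hL, resp_Xbar hS] at this
    exact this ⟨hy.1, hy.2.le⟩
  have h1 : total h Xbar L y = Function.invFunOn (resp h Xbar L) (Icc (root h Xbar L) Xbar) y := by
    simp [total, hy.2]
  have h2 := Function.invFunOn_mem hex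
  have h3 := Function.invFunOn_eq hex
  rw [← h1] at h2 h3
  refine ⟨⟨h2.1, h2.2.lt_of_ne fun h4 => ?_⟩, h3⟩
  rw [h4, resp_Xbar hS] at h3
  exact hy.2.ne' h3

theorem total_eq (hS : StandingAssumptions h Xbar n) {L : List ℕ} (hL : IsTail n L) {X y : ℝ}
    (hX : X ∈ Ico (root h Xbar L) Xbar) (hy : 0 ≤ y) (h1 : resp h Xbar L X = y) :
    y < Xbar ∧ total h Xbar L y = X := by
  have hm := resp_strictMonoOn hS hL
  have h2 : y < Xbar := by
    have := hm (Ico_subset_Icc_self hX) (right_mem_Icc.2 (root_lt hS hL).le) hX.2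
    rwa [resp_Xbar hS, h1] at this
  have h3 := total_spec hS hL ⟨hy, h2⟩
  exact ⟨h2, hm.injOn (Ico_subset_Icc_self h3.1) (Ico_subset_Icc_self hX) (h3.2.trans h1.symm)⟩

theorem total_zero (hS : StandingAssumptions h Xbar n) {L : List ℕ} (hL : IsTail n L) :
    total h Xbar L 0 = root h Xbar L :=
  (total_eq hS hL (left_mem_Ico.2 (root_lt hS hL)) le_rfl (resp_root hS hL)).2

/-! ## Best responses and the game within a period -/

theorem total_add_eff (hS : StandingAssumptions h Xbar n) {L : List ℕ} (hL : IsTail n (1 :: L))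
    {X z : ℝ} (hX : X ∈ Ico (root h Xbar L) Xbar) (hz : 0 ≤ z)
    (hzX : resp h Xbar (1 :: L) X = z) : total h Xbar L (z + eff h Xbar L X) = X := by
  rw [resp_cons] at hzX
  refine (total_eq hS hL.of_cons hX (add_nonneg hz (eff_pos hS hL.of_cons hX).le) ?_).2
  rw [← hzX]; push_cast; ring

/-- The best response is unique. -/
theorem payoff_lt (hS : StandingAssumptions h Xbar n) {L : List ℕ} (hL : IsTail n (1 :: L))
    {X z e : ℝ} (hX : X ∈ Ico (root h Xbar L) Xbar) (hz : 0 ≤ z)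
    (hzX : resp h Xbar (1 :: L) X = z) (he : 0 ≤ e) (hne : e ≠ eff h Xbar L X) :
    e * h (total h Xbar L (z + e)) < eff h Xbar L X * h X := by
  have hL' := hL.of_cons
  have hr0 := root_nonneg hS hL'
  have hX0 : X ∈ Ico 0 Xbar := ⟨hr0.trans hX.1, hX.2⟩
  have hpos : 0 < eff h Xbar L X * h X := mul_pos (eff_pos hS hL' hX) (h_pos hS hX0)
  rcases le_or_gt Xbar (z + e) with h1 | h1
  · rw [total_of_le h1]
    refine lt_of_le_of_lt (mul_nonpos_of_nonneg_of_nonpos he ?_) hpos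
    rcases h1.eq_or_lt with h2 | h2
    · rw [← h2, hS.saturation]
    · exact (hS.neg_beyond _ h2).le
  obtain ⟨hξ, hξe⟩ := total_spec hS hL' ⟨add_nonneg hz he, h1⟩
  set ξ := total h Xbar L (z + e)
  -- The payoff as a function of the induced total `ζ`. Its derivative is `h'` times `resp (1 :: L)
  -- ζ - z`, which changes sign only at `X`: below `root (1 :: L)` the response is negative, and
  -- above it is increasing. So `V` rises up to `X` and falls afterwards.
  set V : ℝ → ℝ := fun ζ => (resp h Xbar L ζ - z) * h ζ with hV
  set V' : ℝ → ℝ := fun ζ =>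
    derivWithin h (Icc 0 Xbar) ζ * (resp h Xbar (1 :: L) ζ - z) with hV'
  have hd : ∀ ζ ∈ Icc 0 Xbar, HasDerivWithinAt V (V' ζ) (Icc 0 Xbar) ζ := by
    intro ζ hζ
    obtain ⟨h2, h3⟩ := hasDerivWithinAt_resp hS hL'.length_le hζ
    refine ((h2.sub_const z).mul (hasDerivWithinAt_h hS hζ)).congr_deriv ?_
    have h4 : derivWithin h (Icc 0 Xbar) ζ * gFun h Xbar ζ = - h ζ := by
      rw [gFun, mul_div_cancel₀ _ (hS.deriv_neg ζ hζ).ne]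
    rw [hV']
    simp only [resp_cons, ← h3]
    push_cast
    linear_combination (derivWithin (resp h Xbar L) (Icc 0 Xbar) ζ) * h4
  have hVX : V X = eff h Xbar L X * h X := by
    rw [resp_cons] at hzX
    simp only [hV, ← hzX]; push_cast; ring
  have hVξ : V ξ = e * h ξ := by simp only [hV, hξe]; ring
  rw [← hVX, ← hVξ]
  have hXr : root h Xbar (1 :: L) ≤ X := root_cons_le hS hL hX.1 (hzX ▸ hz)
  have hm := resp_strictMonoOn hS hL
  rcases lt_trichotomy ξ X with h2 | h2 | h2
  · refine strictMonoOn_of_derivWithin (hr0.trans hξ.1) hX.2.le hd (fun ζ hζ => ?_)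
      (left_mem_Icc.2 h2.le) (right_mem_Icc.2 h2.le) h2
    refine mul_pos_of_neg_of_neg
      (hS.deriv_neg ζ ⟨(hr0.trans hξ.1).trans hζ.1.le, (hζ.2.trans hX.2).le⟩) (sub_neg.2 ?_)
    rcases lt_or_ge ζ (root h Xbar (1 :: L)) with h3 | h3
    · exact ((root_cons_spec hS hL).2.1 ζ ⟨hξ.1.trans hζ.1.le, h3⟩).trans_le hz
    · rw [← hzX]
      exact hm ⟨h3, (hζ.2.trans hX.2).le⟩ ⟨hXr, hX.2.le⟩ hζ.2
  · exfalso
    apply hne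
    rw [h2] at hξe
    rw [resp_cons] at hzX
    push_cast at hzX; linarith
  · have := strictMonoOn_of_derivWithin hX0.1 hξ.2.le (fun ζ hζ => (hd ζ hζ).neg) (fun ζ hζ => ?_)
      (left_mem_Icc.2 h2.le) (right_mem_Icc.2 h2.le) h2
    · simpa using this
    have h3 : ζ ∈ Icc 0 Xbar := ⟨hX0.1.trans hζ.1.le, (hζ.2.trans hξ.2).le⟩
    refine neg_pos.2 (mul_neg_of_neg_of_pos (hS.deriv_neg ζ h3) (sub_pos.2 ?_))
    rw [← hzX]
    exact hm ⟨hXr, hX.2.le⟩ ⟨hXr.trans hζ.1.le, h3.2⟩ hζ.1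

/-- Equilibrium effort, after observing `y`, of a player in a period with `a` players that is
followed by periods with block sizes `L`. -/
noncomputable def stageEffort (h : ℝ → ℝ) (Xbar : ℝ) (a : ℕ) (L : List ℕ) (y : ℝ) : ℝ :=
  if y < Xbar then eff h Xbar L (total h Xbar (a :: L) y) else 0

theorem total_cons_mem (hS : StandingAssumptions h Xbar n) {a : ℕ} {L : List ℕ}
    (hL : IsTail n (a :: L)) {y : ℝ} (hy : y ∈ Ico 0 Xbar) :
    total h Xbar (a :: L) y ∈ Ico (root h Xbar L) Xbar :=
  ⟨(root_le_root_cons hS hL).trans (total_spec hS hL hy).1.1, (total_spec hS hL hy).1.2⟩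

theorem stageEffort_nonneg (hS : StandingAssumptions h Xbar n) {a : ℕ} {L : List ℕ}
    (hL : IsTail n (a :: L)) {y : ℝ} (hy : 0 ≤ y) : 0 ≤ stageEffort h Xbar a L y := by
  rw [stageEffort]
  split_ifs with h1
  · exact (eff_pos hS hL.of_cons (total_cons_mem hS hL ⟨hy, h1⟩)).le
  · exact le_rfl

theorem total_stage (hS : StandingAssumptions h Xbar n) {a : ℕ} {L : List ℕ}
    (hL : IsTail n (a :: L)) {y : ℝ} (hy : 0 ≤ y) :
    total h Xbar L (y + a * stageEffort h Xbar a L y) = total h Xbar (a :: L) y := by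
  have h2 := stageEffort_nonneg hS hL hy
  rw [stageEffort] at h2 ⊢
  split_ifs at h2 ⊢ with h1
  · have h3 := (total_spec hS hL ⟨hy, h1⟩).2
    rw [resp_cons] at h3
    refine (total_eq hS hL.of_cons (total_cons_mem hS hL ⟨hy, h1⟩) (by positivity) ?_).2
    linarith
  · simp [total_of_le (not_lt.1 h1)]

variable {ι : Type*} [DecidableEq ι]

/-- All members of a period face the same final total, and a best response is a function of that
total alone. So the efforts coincide, and summing them gives the equation `resp (a :: L) = y`. -/
theorem stage_unique (hS : StandingAssumptions h Xbar n) {a : ℕ} {L : List ℕ}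
    (hL : IsTail n (a :: L)) {s : Finset ι} (hs : s.card = a) {y : ℝ} (hy : 0 ≤ y) {x : ι → ℝ}
    (hx : ∀ i ∈ s, 0 ≤ x i)
    (hbr : ∀ i ∈ s, ∀ e, 0 ≤ e → e * h (total h Xbar L (y + ∑ j ∈ s.erase i, x j + e)) ≤
      x i * h (total h Xbar L (y + ∑ j ∈ s.erase i, x j + x i))) :
    ∀ i ∈ s, x i = stageEffort h Xbar a L y := by
  set Y := y + ∑ j ∈ s, x j with hY
  have hz : ∀ i ∈ s, y + ∑ j ∈ s.erase i, x j + x i = Y := fun i hi => by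
    rw [add_assoc, Finset.sum_erase_add _ _ hi]
  have hz0 : ∀ i ∈ s, 0 ≤ y + ∑ j ∈ s.erase i, x j := fun i _ =>
    add_nonneg hy (Finset.sum_nonneg fun j hj => hx j (Finset.mem_of_mem_erase hj))
  have hpay : ∀ i ∈ s, 0 ≤ x i * h (total h Xbar L Y) := fun i hi => by
    have := hbr i hi 0 le_rfl
    rwa [zero_mul, hz i hi] at this
  have hyY : y ≤ Y := le_add_of_nonneg_right (Finset.sum_nonneg hx)
  have hY' : Xbar < Y → ∀ i ∈ s, x i = 0 := by
    intro h1 i hi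
    have h2 := hpay i hi
    rw [total_of_le h1.le] at h2
    have h3 := hS.neg_beyond Y h1
    have h4 := hx i hi
    by_contra h5
    exact absurd h2 (not_le.2 (mul_neg_of_pos_of_neg (lt_of_le_of_ne h4 (Ne.symm h5)) h3))
  have hL1 := hL.one_cons
  have hBR : ∀ i ∈ s, y + ∑ j ∈ s.erase i, x j < Xbar →
      ∃ X ∈ Ico (root h Xbar L) Xbar,
        resp h Xbar (1 :: L) X = y + ∑ j ∈ s.erase i, x j ∧ x i = eff h Xbar L X ∧
          total h Xbar L Y = X := by
    intro i hi h1
    have h2 := total_spec hS hL1 ⟨hz0 i hi, h1⟩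
    have h3 := total_cons_mem hS hL1 ⟨hz0 i hi, h1⟩
    have h5 := total_add_eff hS hL1 h3 (hz0 i hi) h2.2
    have h4 : x i = eff h Xbar L (total h Xbar (1 :: L) (y + ∑ j ∈ s.erase i, x j)) := by
      by_contra hne
      have h4 := payoff_lt hS hL1 h3 (hz0 i hi) h2.2 (hx i hi) hne
      have h6 := hbr i hi _ (eff_pos hS hL.of_cons h3).le
      rw [h5] at h6
      exact absurd h4 (not_lt.2 h6)
    refine ⟨_, h3, h2.2, h4, ?_⟩
    rw [← hz i hi, h4, h5]
  intro i hi
  rw [stageEffort]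
  split_ifs with h1
  · have hYlt : Y < Xbar := by
      by_contra! h2
      have h3 : ∃ j ∈ s, 0 < x j := by
        by_contra! h3
        have : Y ≤ y := by
          rw [hY]; linarith [Finset.sum_nonpos h3]
        linarith
      obtain ⟨j, hj, h3⟩ := h3
      have h4 : Y = Xbar := le_antisymm (not_lt.1 fun h4 => h3.ne' (hY' h4 j hj)) h2
      obtain ⟨X, hX, -, -, h5⟩ := hBR j hj (by linarith [hz j hj])
      rw [h4, total_of_le le_rfl] at h5
      exact hX.2.ne' h5
    have hall : ∀ j ∈ s, x j = eff h Xbar L (total h Xbar L Y) := fun j hj => by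
      obtain ⟨X, -, -, h2, h3⟩ := hBR j hj (by linarith [hz j hj, hx j hj])
      rw [h2, h3]
    have hTY := total_spec hS hL.of_cons ⟨hy.trans hyY, hYlt⟩
    have hr : resp h Xbar (a :: L) (total h Xbar L Y) = y := by
      have h2 := Finset.sum_congr rfl hall
      rw [Finset.sum_const, hs, nsmul_eq_mul] at h2
      rw [resp_cons, hTY.2, ← h2, hY, add_sub_cancel_right]
    rw [hall i hi]
    congr 1
    refine (total_eq hS hL ⟨?_, hTY.1.2⟩ hy hr).2.symm
    exact root_cons_le hS hL hTY.1.1 (hr ▸ hy)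
  · rcases (not_lt.1 h1).trans hyY |>.eq_or_lt with h2 | h2
    · have : ∑ j ∈ s, x j = 0 := by
        have := Finset.sum_nonneg hx
        linarith
      exact (Finset.sum_eq_zero_iff_of_nonneg hx).1 this i hi
    · exact hY' h2 i hi

/-- Against `a - 1` others at the stage effort, the single-player condition `resp (1 :: L) = z` is
`resp (a :: L) = y` with their efforts moved to the other side. -/
theorem stage_optimal (hS : StandingAssumptions h Xbar n) {a : ℕ} {L : List ℕ}
    (hL : IsTail n (a :: L)) {y e : ℝ} (hy : 0 ≤ y) (he : 0 ≤ e) :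
    e * h (total h Xbar L (y + (a - 1) * stageEffort h Xbar a L y + e)) ≤
      stageEffort h Xbar a L y * h (total h Xbar L (y + (a - 1) * stageEffort h Xbar a L y +
        stageEffort h Xbar a L y)) := by
  have ha : (1 : ℝ) ≤ a := by exact_mod_cast hL.1 a (by simp)
  have h2 := stageEffort_nonneg hS hL hy
  have h3 := total_stage hS hL hy
  have hz0 : 0 ≤ y + (a - 1) * stageEffort h Xbar a L y :=
    add_nonneg hy (mul_nonneg (by linarith) h2)
  have h4 : y + (a - 1) * stageEffort h Xbar a L y + stageEffort h Xbar a L y =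
    y + a * stageEffort h Xbar a L y := by ring
  rw [h4, h3]
  rcases lt_or_ge y Xbar with h1 | h1
  · have h5 := total_cons_mem hS hL ⟨hy, h1⟩
    have h6 := (total_spec hS hL ⟨hy, h1⟩).2
    have h7 : stageEffort h Xbar a L y = eff h Xbar L (total h Xbar (a :: L) y) := by
      rw [stageEffort, if_pos h1]
    by_cases hne : e = stageEffort h Xbar a L y
    · rw [hne, h4, h3]
    · rw [h7] at hne hz0 ⊢
      refine (payoff_lt hS hL.one_cons h5 hz0 ?_ he hne).le
      rw [resp_cons] at h6 ⊢
      push_cast; linarith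
  · have h7 : stageEffort h Xbar a L y = 0 := by rw [stageEffort, if_neg (not_lt.2 h1)]
    rw [h7, zero_mul, mul_zero, add_zero, total_of_le (by linarith)]
    refine mul_nonpos_of_nonneg_of_nonpos he ?_
    rcases (show Xbar ≤ y + e by linarith).eq_or_lt with h8 | h8
    · rw [← h8, hS.saturation]
    · exact (hS.neg_beyond _ h8).le

/-! ## Cumulative efforts -/

theorem cumEffort_of_le (c : Composition n) (σ : Fin n → ℝ → ℝ) {t s : ℕ} (y : ℝ) (hs : s ≤ t) :
    cumEffort c σ t y s = y := by
  cases s with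
  | zero => rfl
  | succ s => rw [cumEffort, if_pos (by omega)]

theorem cumEffort_succ (c : Composition n) (σ : Fin n → ℝ → ℝ) {t s : ℕ} (y : ℝ) (hs : t ≤ s) :
    cumEffort c σ t y (s + 1) = cumEffort c σ t y s +
      ∑ i : Fin n with (c.index i : ℕ) = s, σ i (cumEffort c σ t y s) := by
  rw [cumEffort, if_neg (by omega)]

theorem cumEffort_restart (c : Composition n) (σ : Fin n → ℝ → ℝ) {t t' s : ℕ} (y : ℝ)
    (ht : t ≤ t') (hs : t' ≤ s) :
    cumEffort c σ t y s = cumEffort c σ t' (cumEffort c σ t y t') s := by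
  induction s, hs using Nat.le_induction with
  | base => rw [cumEffort_of_le _ _ _ le_rfl]
  | succ s hs ih => rw [cumEffort_succ _ _ _ (ht.trans hs), cumEffort_succ _ _ _ hs, ih]

theorem cumEffort_congr (c : Composition n) {σ σ' : Fin n → ℝ → ℝ} {t s : ℕ} (y : ℝ)
    (hσ : ∀ i, t ≤ (c.index i : ℕ) → (c.index i : ℕ) < s → σ i = σ' i) :
    cumEffort c σ t y s = cumEffort c σ' t y s := by
  induction s with
  | zero => rfl
  | succ s ih =>
    rcases Nat.lt_or_ge s t with h1 | h1
    · rw [cumEffort_of_le _ _ _ h1, cumEffort_of_le _ _ _ h1]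
    · rw [cumEffort_succ _ _ _ h1, cumEffort_succ _ _ _ h1, ih fun i h2 h3 => hσ i h2 (by omega)]
      congr 1
      refine Finset.sum_congr rfl fun i hi => ?_
      have := (Finset.mem_filter.1 hi).2
      rw [hσ i (by omega) (by omega)]

theorem cumEffort_nonneg (c : Composition n) {σ : Fin n → ℝ → ℝ} (hσ : ∀ i, IsStrategy (σ i))
    {t s : ℕ} {y : ℝ} (hy : 0 ≤ y) : 0 ≤ cumEffort c σ t y s := by
  induction s with
  | zero => exact hy
  | succ s ih =>
    rcases Nat.lt_or_ge s t with h1 | h1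
    · rwa [cumEffort_of_le _ _ _ h1]
    · rw [cumEffort_succ _ _ _ h1]
      exact add_nonneg ih (Finset.sum_nonneg fun i _ => hσ i _ ih)

theorem cumEffort_eq_sum (c : Composition n) (σ : Fin n → ℝ → ℝ) (s : ℕ) :
    cumEffort c σ 0 0 s = ∑ i : Fin n with (c.index i : ℕ) < s, effortFrom c σ 0 0 i := by
  induction s with
  | zero => simp [cumEffort]
  | succ s ih =>
    have h1 : (Finset.univ.filter fun i : Fin n => (c.index i : ℕ) < s + 1) =
        (Finset.univ.filter fun i : Fin n => (c.index i : ℕ) < s) ∪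
        (Finset.univ.filter fun i : Fin n => (c.index i : ℕ) = s) := by
      ext i; simp; omega
    rw [cumEffort_succ _ _ _ (Nat.zero_le s), h1, Finset.sum_union, ← ih]
    · congr 1
      refine Finset.sum_congr rfl fun i hi => ?_
      rw [effortFrom, (Finset.mem_filter.1 hi).2]
    · rw [Finset.disjoint_filter]; intro i _ h2; omega

theorem cumEffort_length (c : Composition n) (σ : Fin n → ℝ → ℝ) :
    cumEffort c σ 0 0 c.length = ∑ i, effortFrom c σ 0 0 i := by
  rw [cumEffort_eq_sum, Finset.filter_true_of_mem fun i _ => (c.index i).2]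

/-- The players who arrive in period `t`. -/
def players (c : Composition n) (t : ℕ) : Finset (Fin n) :=
  Finset.univ.filter fun i => (c.index i : ℕ) = t

theorem mem_players {c : Composition n} {t : ℕ} {i : Fin n} :
    i ∈ players c t ↔ (c.index i : ℕ) = t := by simp [players]

theorem card_players (c : Composition n) (t : Fin c.length) :
    (players c t).card = c.blocksFun t := by
  have h1 : players c t = Finset.univ.map (c.embedding t).toEmbedding := by
    ext i
    rw [mem_players, Finset.mem_map]
    simp only [Finset.mem_univ, true_and, RelEmbedding.coe_toEmbedding]
    have h2 := c.mem_range_embedding_iff' (j := i) (i := t)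
    rw [← Fin.ext_iff, eq_comm, ← h2]; rfl
  rw [h1, Finset.card_map, Finset.card_univ, Fintype.card_fin]

theorem drop_blocks (c : Composition n) (t : Fin c.length) :
    c.blocks.drop t = c.blocksFun t :: c.blocks.drop (t + 1) :=
  List.drop_eq_getElem_cons _

theorem payoffFrom_update (h : ℝ → ℝ) (c : Composition n) (σ : Fin n → ℝ → ℝ) {t : ℕ} {y : ℝ}
    {i : Fin n} (hi : t ≤ (c.index i : ℕ)) (τ : ℝ → ℝ) :
    payoffFrom h c (Function.update σ i τ) t y i =
      τ (cumEffort c σ t y (c.index i)) *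
        h (cumEffort c σ (c.index i + 1) (cumEffort c σ t y (c.index i) +
          ∑ j ∈ (players c (c.index i)).erase i, σ j (cumEffort c σ t y (c.index i)) +
          τ (cumEffort c σ t y (c.index i))) c.length) := by
  have h1 : cumEffort c (Function.update σ i τ) t y (c.index i) =
      cumEffort c σ t y (c.index i) :=
    cumEffort_congr c y fun j _ h3 => Function.update_of_ne (by rintro rfl; omega) _ _
  have h2 : cumEffort c (Function.update σ i τ) t y (c.index i + 1) =
      cumEffort c σ t y (c.index i) +
        ∑ j ∈ (players c (c.index i)).erase i, σ j (cumEffort c σ t y (c.index i)) +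
        τ (cumEffort c σ t y (c.index i)) := by
    rw [cumEffort_succ _ _ _ hi, h1, add_assoc]
    congr 1
    change ∑ j ∈ players c (c.index i), _ = _
    rw [← Finset.sum_erase_add _ _ (mem_players.2 rfl), Function.update_self]
    congr 1
    refine Finset.sum_congr rfl fun j hj => ?_
    rw [Function.update_of_ne (Finset.ne_of_mem_erase hj)]
  rw [payoffFrom, effortFrom, h1, Function.update_self,
    cumEffort_restart c _ y (show t ≤ c.index i + 1 by omega) (c.index i).2, h2]
  congr 2
  exact cumEffort_congr c _ fun j h3 _ => Function.update_of_ne (by rintro rfl; omega) _ _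

/-- One-shot deviations suffice: each player moves once, so a deviating strategy matters only
through its value at the observed cumulative effort. -/
theorem isSPNE_iff (h : ℝ → ℝ) (c : Composition n) (σ : Fin n → ℝ → ℝ) :
    IsSPNE h c σ ↔ (∀ i, IsStrategy (σ i)) ∧
      ∀ i : Fin n, ∀ y : ℝ, 0 ≤ y → ((c.index i : ℕ) = 0 → y = 0) → ∀ e, 0 ≤ e →
        e * h (cumEffort c σ (c.index i + 1)
          (y + ∑ j ∈ (players c (c.index i)).erase i, σ j y + e) c.length) ≤
        σ i y * h (cumEffort c σ (c.index i + 1)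
          (y + ∑ j ∈ (players c (c.index i)).erase i, σ j y + σ i y) c.length) := by
  constructor
  · rintro ⟨h1, h2⟩
    refine ⟨h1, fun i y hy hy0 e he => ?_⟩
    have h3 := h2 (c.index i) (c.index i).2 y hy hy0 i le_rfl (fun _ => e) fun _ _ => he
    -- Writing `σ` as its own update lets `payoffFrom_update` expand the equilibrium payoff as well.
    rw [payoffFrom_update h c σ le_rfl, ← Function.update_eq_self i σ,
      payoffFrom_update h c _ le_rfl, Function.update_eq_self i σ,
      cumEffort_of_le _ _ _ le_rfl] at h3
    exact h3
  · rintro ⟨h1, h2⟩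
    refine ⟨h1, fun t _ y hy hy0 i hi τ hτ => ?_⟩
    have h5 := cumEffort_nonneg c h1 (t := t) (s := c.index i) hy
    have h3 := h2 i (cumEffort c σ t y (c.index i)) h5 (fun h4 => by
      rw [h4]; exact hy0 (by omega)) (τ (cumEffort c σ t y (c.index i))) (hτ _ h5)
    have h6 : payoffFrom h c σ t y i = payoffFrom h c (Function.update σ i (σ i)) t y i := by
      rw [Function.update_eq_self]
    rw [h6, payoffFrom_update h c σ hi, payoffFrom_update h c σ hi]
    exact h3

/-! ## The equilibrium -/

/-- The equilibrium strategies. -/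
noncomputable def strat (h : ℝ → ℝ) (Xbar : ℝ) (c : Composition n) (i : Fin n) (y : ℝ) : ℝ :=
  stageEffort h Xbar (c.blocksFun (c.index i)) (c.blocks.drop (c.index i + 1)) y

/-- Agreement with `strat` is required only at arguments that belong to subgames, so that the lemma
serves both existence and the backward induction for uniqueness. -/
theorem cumEffort_eq_total (hS : StandingAssumptions h Xbar n) (c : Composition n)
    {σ : Fin n → ℝ → ℝ} {t : ℕ} (ht : t ≤ c.length) {y : ℝ} (hy : 0 ≤ y) (hy0 : t = 0 → y = 0)
    (hσ : ∀ i, t ≤ (c.index i : ℕ) → ∀ z, 0 ≤ z → ((c.index i : ℕ) = 0 → z = 0) →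
      σ i z = strat h Xbar c i z) :
    cumEffort c σ t y c.length = total h Xbar (c.blocks.drop t) y := by
  induction ht using Nat.decreasingInduction generalizing y with
  | self =>
    rw [cumEffort_of_le _ _ _ le_rfl, ← c.blocks_length, List.drop_length]
    rcases lt_or_ge y Xbar with h1 | h1
    · have := (total_spec hS (L := []) ⟨by simp, by simp⟩ ⟨hy, h1⟩).2
      rw [resp_nil] at this
      exact this.symm
    · exact (total_of_le h1).symm
  | of_succ t ht ih =>
    have hL := isTail_drop c t
    have hd := drop_blocks c ⟨t, ht⟩
    simp only at hd
    rw [hd] at hL ⊢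
    rw [cumEffort_restart c σ y t.le_succ ht, cumEffort_succ c σ y le_rfl,
      cumEffort_of_le c σ y le_rfl]
    have h1 : ∑ i : Fin n with (c.index i : ℕ) = t, σ i y =
        c.blocksFun ⟨t, ht⟩ *
          stageEffort h Xbar (c.blocksFun ⟨t, ht⟩) (c.blocks.drop (t + 1)) y := by
      have h2 : ∀ i ∈ players c t, σ i y =
          stageEffort h Xbar (c.blocksFun ⟨t, ht⟩) (c.blocks.drop (t + 1)) y := by
        intro i hi
        have hi := mem_players.1 hi
        have h3 : c.index i = ⟨t, ht⟩ := Fin.ext hi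
        rw [hσ i hi.ge y hy (by rw [hi]; exact hy0), strat, h3]
      change ∑ i ∈ players c t, σ i y = _
      rw [Finset.sum_congr rfl h2, Finset.sum_const, card_players c ⟨t, ht⟩, nsmul_eq_mul]
    rw [h1, ih (add_nonneg hy (mul_nonneg (Nat.cast_nonneg _) (stageEffort_nonneg hS hL hy)))
      (by omega) fun i hi => hσ i (by omega), total_stage hS hL hy]

theorem isSPNE_strat (hS : StandingAssumptions h Xbar n) (c : Composition n) :
    IsSPNE h c (strat h Xbar c) := by
  have hL : ∀ i : Fin n,
      IsTail n (c.blocksFun (c.index i) :: c.blocks.drop (c.index i + 1)) := fun i => by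
    rw [← drop_blocks]; exact isTail_drop c _
  have hnn : ∀ i, IsStrategy (strat h Xbar c i) := fun i y hy => stageEffort_nonneg hS (hL i) hy
  refine (isSPNE_iff h c _).2 ⟨hnn, fun i y hy _ e he => ?_⟩
  have h1 : ∑ j ∈ (players c (c.index i)).erase i, strat h Xbar c j y =
      ((c.blocksFun (c.index i) : ℝ) - 1) * strat h Xbar c i y := by
    have h2 : ∀ j ∈ (players c (c.index i)).erase i,
        strat h Xbar c j y = strat h Xbar c i y := fun j hj => by
      have := mem_players.1 (Finset.mem_of_mem_erase hj)
      have h3 : c.index j = c.index i := Fin.ext this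
      rw [strat, h3, strat]
    rw [Finset.sum_congr rfl h2, Finset.sum_const, Finset.card_erase_of_mem (mem_players.2 rfl),
      card_players, nsmul_eq_mul, Nat.cast_sub (c.one_le_blocksFun _)]
    simp
  have hb : (1 : ℝ) ≤ c.blocksFun (c.index i) := by exact_mod_cast c.one_le_blocksFun _
  have hs0 := hnn i y hy
  have h4 : 0 ≤ y + ∑ j ∈ (players c (c.index i)).erase i, strat h Xbar c j y := by
    rw [h1]; exact add_nonneg hy (mul_nonneg (by linarith) hs0)
  rw [cumEffort_eq_total hS c (c.index i).2 (add_nonneg h4 he) (by omega) fun _ _ _ _ _ => rfl,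
    cumEffort_eq_total hS c (c.index i).2 (add_nonneg h4 hs0) (by omega) fun _ _ _ _ _ => rfl, h1]
  exact stage_optimal hS (hL i) hy he

/-- Backward induction with `stage_unique`. Equilibrium does not restrict strategies at negative
arguments, nor in the first period away from `0`; hence the side conditions. -/
theorem eq_strat (hS : StandingAssumptions h Xbar n) {c : Composition n}
    {σ : Fin n → ℝ → ℝ} (hσ : IsSPNE h c σ) {i : Fin n} {y : ℝ} (hy : 0 ≤ y)
    (hy0 : (c.index i : ℕ) = 0 → y = 0) : σ i y = strat h Xbar c i y := by
  have hσ' := (isSPNE_iff h c σ).1 hσ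
  have key : ∀ t ≤ c.length, ∀ i, t ≤ (c.index i : ℕ) → ∀ z, 0 ≤ z →
      ((c.index i : ℕ) = 0 → z = 0) → σ i z = strat h Xbar c i z := by
    intro t ht
    induction ht using Nat.decreasingInduction with
    | self => intro i hi; exact absurd (c.index i).2 (not_lt.2 hi)
    | of_succ t ht ih =>
      intro i hi z hz hz0
      rcases hi.eq_or_lt with h1 | h1
      · have hL := isTail_drop c t
        have hd := drop_blocks c ⟨t, ht⟩
        simp only at hd
        rw [hd] at hL
        have h3 : c.index i = ⟨t, ht⟩ := Fin.ext h1.symm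
        have h2 := stage_unique hS hL (card_players c ⟨t, ht⟩) hz (x := fun j => σ j z)
          (fun j _ => hσ'.1 j z hz) (fun j hj e he => ?_) i (mem_players.2 h1.symm)
        · rw [h2, strat, h3]
        · have hj := mem_players.1 hj
          simp only at hj
          have h4 : 0 ≤ z + ∑ k ∈ (players c t).erase j, σ k z :=
            add_nonneg hz (Finset.sum_nonneg fun k _ => hσ'.1 k z hz)
          have h5 := hσ'.2 j z hz (by rw [hj, h1]; exact hz0) e he
          rw [hj, cumEffort_eq_total hS c ht (add_nonneg h4 he) (by omega) ih,
            cumEffort_eq_total hS c ht (add_nonneg h4 (hσ'.1 j z hz)) (by omega) ih] at h5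
          exact h5
      · exact ih i h1 z hz hz0
  exact key 0 (Nat.zero_le _) i (Nat.zero_le _) y hy hy0

/-- The efforts on the equilibrium path. -/
noncomputable def profile (h : ℝ → ℝ) (Xbar : ℝ) (c : Composition n) (i : Fin n) : ℝ :=
  eff h Xbar (c.blocks.drop (c.index i + 1)) (root h Xbar c.blocks)

theorem effortFrom_eq_profile (hS : StandingAssumptions h Xbar n) {c : Composition n}
    {σ : Fin n → ℝ → ℝ} (hσ : IsSPNE h c σ) (i : Fin n) :
    effortFrom c σ 0 0 i = profile h Xbar c i := by
  have hall : ∀ t, ∀ j : Fin n, t ≤ (c.index j : ℕ) → ∀ z, 0 ≤ z →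
      ((c.index j : ℕ) = 0 → z = 0) → σ j z = strat h Xbar c j z :=
    fun t j _ z hz hz0 => eq_strat hS hσ hz hz0
  set s : ℕ := (c.index i : ℕ) with hs
  set y := cumEffort c σ 0 0 s with hy
  have hy0 : 0 ≤ y := cumEffort_nonneg c hσ.1 le_rfl
  have hys : s = 0 → y = 0 := fun h1 => by rw [hy, h1]; rfl
  have hsl : s < c.length := (c.index i).2
  have h1 : total h Xbar (c.blocks.drop s) y = root h Xbar c.blocks := by
    rw [← cumEffort_eq_total hS c hsl.le hy0 hys (hall s), hy,
      ← cumEffort_restart c σ 0 (Nat.zero_le _) hsl.le,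
      cumEffort_eq_total hS c (Nat.zero_le _) le_rfl (fun _ => rfl) (hall 0), List.drop_zero,
      total_zero hS (isTail_blocks c)]
  have h2 : y < Xbar := by
    by_contra! h2
    rw [total_of_le h2] at h1
    linarith [root_lt hS (isTail_blocks c)]
  rw [effortFrom, ← hs, ← hy, eq_strat hS hσ hy0 hys, strat, stageEffort, if_pos h2,
    ← drop_blocks, ← hs, h1, profile, ← hs]

theorem isEquilibriumProfile_iff (hS : StandingAssumptions h Xbar n) {c : Composition n}
    {x : Fin n → ℝ} : IsEquilibriumProfile h c x ↔ x = profile h Xbar c := by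
  constructor
  · rintro ⟨σ, hσ, hx⟩
    funext i
    rw [hx, effortFrom_eq_profile hS hσ]
  · rintro rfl
    exact ⟨_, isSPNE_strat hS c, fun i => (effortFrom_eq_profile hS (isSPNE_strat hS c) i).symm⟩

theorem sum_profile (hS : StandingAssumptions h Xbar n) (c : Composition n) :
    ∑ i, profile h Xbar c i = root h Xbar c.blocks := by
  have h1 := isSPNE_strat hS c
  rw [← Finset.sum_congr rfl fun i _ => effortFrom_eq_profile hS h1 i, ← cumEffort_length,
    cumEffort_eq_total hS c (Nat.zero_le _) le_rfl (fun _ => rfl) (fun _ _ _ _ _ => rfl),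
    List.drop_zero, total_zero hS (isTail_blocks c)]

/-! ## The highest effort -/

theorem gTerm_pos (hS : StandingAssumptions h Xbar n) (c : Composition n) {k : ℕ}
    (hk : k < c.length) : 0 < gTerm h Xbar k (root h Xbar c.blocks) := by
  rcases Nat.eq_zero_or_pos k with rfl | h1
  · exact gFun_pos hS (root_mem hS (isTail_blocks c))
  · have := hS.substitutes c _ ((isEquilibriumProfile_iff hS).2 rfl) (k + 1) (by omega) (by omega)
    rwa [sum_profile hS] at this

/-- The effort of the players of the first period. -/
noncomputable def leadEffort (h : ℝ → ℝ) (Xbar : ℝ) (L : List ℕ) : ℝ :=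
  eff h Xbar L.tail (root h Xbar L)

theorem eff_le_eff_cons {a : ℕ} {L : List ℕ} {X : ℝ}
    (hpos : ∀ k < L.length + 2, 0 < gTerm h Xbar k X) :
    eff h Xbar L X ≤ eff h Xbar (a :: L) X := by
  rw [eff_cons]
  refine le_add_of_nonneg_right (mul_nonneg (Nat.cast_nonneg _) (Finset.sum_nonneg fun k hk => ?_))
  exact mul_nonneg (Nat.cast_nonneg _) (hpos _ (by have := Finset.mem_range.1 hk; omega)).le

/-- Moving one period earlier adds a block to the followers, which raises `eff` because all `g_k`
involved are positive at the equilibrium total. -/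
theorem profile_le (hS : StandingAssumptions h Xbar n) (c : Composition n) (i : Fin n) :
    profile h Xbar c i ≤ leadEffort h Xbar c.blocks := by
  have key : ∀ m < c.length, eff h Xbar (c.blocks.drop (m + 1)) (root h Xbar c.blocks) ≤
      leadEffort h Xbar c.blocks := by
    intro m hm
    induction m with
    | zero => rw [leadEffort, ← List.drop_one]
    | succ m ih =>
      refine le_trans ?_ (ih (by omega))
      rw [drop_blocks c ⟨m + 1, hm⟩]
      refine eff_le_eff_cons fun k hk => gTerm_pos hS c ?_
      have := c.blocks_length
      simp only [List.length_drop] at hk; omega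
  exact key _ (c.index i).2

theorem index_zero (c : Composition n) (hn : 0 < n) : (c.index ⟨0, hn⟩ : ℕ) = 0 := by
  have h1 := c.sizeUpTo_index_le ⟨0, hn⟩
  by_contra h2
  have h3 := c.sizeUpTo_strict_mono (i := 0) (c.length_pos_of_pos hn)
  have h4 := c.monotone_sizeUpTo (show 0 + 1 ≤ (c.index ⟨0, hn⟩ : ℕ) by omega)
  simp only at h1
  omega

theorem profile_zero (c : Composition n) (hn : 0 < n) :
    profile h Xbar c ⟨0, hn⟩ = leadEffort h Xbar c.blocks := by
  rw [profile, index_zero, leadEffort, zero_add, List.drop_one]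

theorem isHighestEffort_iff (hS : StandingAssumptions h Xbar n) (hn : 0 < n) {c : Composition n}
    {m : ℝ} : IsHighestEffort h c m ↔ m = leadEffort h Xbar c.blocks := by
  have h1 : IsGreatest (range (profile h Xbar c)) (leadEffort h Xbar c.blocks) :=
    ⟨⟨_, profile_zero c hn⟩, by rintro _ ⟨i, rfl⟩; exact profile_le hS c i⟩
  constructor
  · rintro ⟨x, hx, hm⟩
    rw [(isEquilibriumProfile_iff hS).1 hx] at hm
    exact hm.unique h1
  · rintro rfl
    exact ⟨_, (isEquilibriumProfile_iff hS).2 rfl, h1⟩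

theorem maximizes_iff (hS : StandingAssumptions h Xbar n) (hn : 0 < n) {c : Composition n} :
    MaximizesHighestEffort h c ↔
      ∀ c' : Composition n, leadEffort h Xbar c'.blocks ≤ leadEffort h Xbar c.blocks := by
  simp only [MaximizesHighestEffort, isHighestEffort_iff hS hn]
  simp

theorem minimizes_iff (hS : StandingAssumptions h Xbar n) (hn : 0 < n) {c : Composition n} :
    MinimizesHighestEffort h c ↔
      ∀ c' : Composition n, leadEffort h Xbar c.blocks ≤ leadEffort h Xbar c'.blocks := by
  simp only [MinimizesHighestEffort, isHighestEffort_iff hS hn]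
  simp

/-! ## The simultaneous contest -/

theorem esym_one (L : List ℕ) : esym L 1 = L.sum := by
  induction L with
  | nil => rfl
  | cons a L ih => rw [esym_cons, ih, esym_zero, List.sum_cons]; ring

theorem esym_pos {L : List ℕ} (hL : ∀ a ∈ L, 0 < a) {k : ℕ} (hk : k ≤ L.length) :
    0 < esym L k := by
  induction L generalizing k with
  | nil => obtain rfl : k = 0 := by simpa using hk
           simp
  | cons a L ih =>
    cases k with
    | zero => simp
    | succ k =>
      rw [esym_cons]
      exact Nat.add_pos_right _ (Nat.mul_pos (hL a (by simp))
        (ih (fun b hb => hL b (by simp [hb])) (by simpa using hk)))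

theorem resp_single (X : ℝ) : resp h Xbar [n] X = X - n * gFun h Xbar X := by
  rw [resp_cons, resp_nil, eff_nil]

theorem isTail_single (hn : 0 < n) : IsTail n [n] := ⟨by simpa using hn, by simp⟩

/-- At the root of `f_0` the total equals `∑ S_k g_k`, and `S_1 = n`. What is left after subtracting
`n g` is the sum over `k ≥ 2`, nonempty as soon as there are two periods. -/
theorem resp_single_nonneg (hS : StandingAssumptions h Xbar n) (c : Composition n) :
    0 ≤ resp h Xbar [n] (root h Xbar c.blocks) ∧
      (1 < c.length → 0 < resp h Xbar [n] (root h Xbar c.blocks)) := by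
  have h0 := resp_root hS (isTail_blocks c)
  rw [resp, sub_eq_zero] at h0
  rw [resp_single]
  have hterm : ∀ k ∈ Finset.range c.blocks.length,
      0 < (esym c.blocks (k + 1) : ℝ) * gTerm h Xbar k (root h Xbar c.blocks) := fun k hk => by
    have hk := Finset.mem_range.1 hk
    exact mul_pos (Nat.cast_pos.2 (esym_pos (isTail_blocks c).1 hk))
      (gTerm_pos hS c (by simpa using hk))
  have h1 : (n : ℝ) * gFun h Xbar (root h Xbar c.blocks) =
      (esym c.blocks (0 + 1) : ℝ) * gTerm h Xbar 0 (root h Xbar c.blocks) := by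
    rw [zero_add, esym_one, c.blocks_sum]; rfl
  rw [h1]
  constructor
  · rcases Nat.eq_zero_or_pos c.blocks.length with h2 | h2
    · have hn : n = 0 := by rw [← c.length_eq_zero, ← c.blocks_length, h2]
      have h3 : root h Xbar c.blocks = 0 := by rw [h0, h2]; simp
      rw [← h1, h3, hn]; simp
    · have := Finset.single_le_sum (fun k hk => (hterm k hk).le) (Finset.mem_range.2 h2)
      rw [← h0] at this
      exact sub_nonneg.2 this
  · intro h2
    rw [← c.blocks_length] at h2
    have := Finset.single_lt_sum (f := fun k : ℕ =>
      (esym c.blocks (k + 1) : ℝ) * gTerm h Xbar k (root h Xbar c.blocks)) (i := 0) (j := 1)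
      one_ne_zero (Finset.mem_range.2 (by omega)) (Finset.mem_range.2 h2)
      (hterm 1 (Finset.mem_range.2 h2)) fun k hk _ => (hterm k hk).le
    rw [← h0] at this
    exact sub_pos.2 this

theorem root_single_le (hS : StandingAssumptions h Xbar n) (hn : 0 < n) (c : Composition n) :
    root h Xbar [n] ≤ root h Xbar c.blocks :=
  root_cons_le hS (isTail_single hn) (root_nonneg hS (isTail_blocks c)) (resp_single_nonneg hS c).1

theorem leadEffort_single (hS : StandingAssumptions h Xbar n) (hn : 0 < n) :
    n * leadEffort h Xbar [n] = root h Xbar [n] := by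
  have := resp_root hS (isTail_single hn)
  rw [resp_single] at this
  rw [leadEffort, List.tail_cons, eff_nil]; linarith

theorem root_le_leadEffort (hS : StandingAssumptions h Xbar n) (c : Composition n) :
    root h Xbar c.blocks ≤ n * leadEffort h Xbar c.blocks := by
  rw [← sum_profile hS c]
  have := Finset.sum_le_card_nsmul Finset.univ _ _ fun i _ => profile_le hS c i
  simpa using this

/-- The simultaneous contest has the lowest total and equal shares; elsewhere the maximum is at
least the average of a larger total. -/
theorem leadEffort_single_le (hS : StandingAssumptions h Xbar n) (hn : 0 < n)
    (c : Composition n) : leadEffort h Xbar [n] ≤ leadEffort h Xbar c.blocks := by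
  have h1 : (0 : ℝ) < n := by exact_mod_cast hn
  refine le_of_mul_le_mul_left ?_ h1
  rw [leadEffort_single hS hn]
  exact (root_single_le hS hn c).trans (root_le_leadEffort hS c)

theorem leadEffort_single_lt (hS : StandingAssumptions h Xbar n) (hn : 0 < n)
    {c : Composition n} (hc : 1 < c.length) :
    leadEffort h Xbar [n] < leadEffort h Xbar c.blocks := by
  have h1 : (0 : ℝ) < n := by exact_mod_cast hn
  refine lt_of_mul_lt_mul_left ?_ h1.le
  rw [leadEffort_single hS hn]
  refine ((root_single_le hS hn c).lt_of_ne fun h2 => ?_).trans_le (root_le_leadEffort hS c)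
  have h3 := (resp_single_nonneg hS c).2 hc
  rw [← h2, resp_root hS (isTail_single hn)] at h3
  exact h3.false

theorem minimizes_iff_single (hS : StandingAssumptions h Xbar n) (hn : 0 < n)
    (c : Composition n) : MinimizesHighestEffort h c ↔ c = Composition.single n hn := by
  rw [minimizes_iff hS hn]
  constructor
  · intro h1
    rw [Composition.eq_single_iff_length]
    have h2 := h1 (Composition.single n hn)
    rw [Composition.single_blocks] at h2
    have h3 := c.length_pos_of_pos hn
    by_contra h4
    exact absurd (leadEffort_single_lt hS hn (c := c) (by omega)) (not_lt.2 h2)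
  · rintro rfl c'
    rw [Composition.single_blocks]
    exact leadEffort_single_le hS hn c'

/-! ## Single leaders -/

theorem leadEffort_split (hS : StandingAssumptions h Xbar n) {c c' : Composition n} {a : ℕ}
    {L : List ℕ} (hc : c.blocks = (1 + a) :: L) (hc' : c'.blocks = 1 :: a :: L) :
    leadEffort h Xbar c.blocks < leadEffort h Xbar c'.blocks := by
  have hT := isTail_blocks c
  have hT' := isTail_blocks c'
  have hpos := fun k => gTerm_pos hS c' (k := k)
  rw [← c'.blocks_length] at hpos
  rw [hc] at hT ⊢
  rw [hc'] at hT' hpos ⊢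
  have ha : (0 : ℝ) < a := by exact_mod_cast hT'.1 a (by simp)
  have h1 : 0 < resp h Xbar ((1 + a) :: L) (root h Xbar (1 :: a :: L)) := by
    have h2 := resp_root hS hT'
    rw [resp_split, sub_eq_zero] at h2
    rw [h2]
    refine mul_pos (by simpa using ha) (Finset.sum_pos (fun k hk => ?_) (by simp))
    have hk := Finset.mem_range.1 hk
    exact mul_pos (Nat.cast_pos.2 (esym_pos hT.of_cons.1 (by omega)))
      (hpos _ (by simp; omega))
  have h2 : root h Xbar L ≤ root h Xbar (1 :: a :: L) :=
    (root_le_root_cons hS hT'.of_cons).trans (root_le_root_cons hS hT')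
  have h3 : root h Xbar ((1 + a) :: L) < root h Xbar (1 :: a :: L) := by
    refine (root_cons_le hS hT h2 h1.le).lt_of_ne fun h3 => ?_
    rw [← h3, resp_root hS hT] at h1
    exact h1.false
  -- In both contests the highest effort is `resp (a :: L)` at the total: before the split because
  -- `1 + a` equal efforts exhaust `resp L`, after it by the leader's own condition.
  have h4 : resp h Xbar (a :: L) (root h Xbar ((1 + a) :: L)) =
      leadEffort h Xbar ((1 + a) :: L) := by
    have := resp_root hS hT
    rw [resp_cons] at this ⊢
    rw [leadEffort, List.tail_cons]
    push_cast at this; linarith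
  have h5 : resp h Xbar (a :: L) (root h Xbar (1 :: a :: L)) =
      leadEffort h Xbar (1 :: a :: L) := by
    have := resp_root hS hT'
    rw [resp_cons] at this
    rw [leadEffort, List.tail_cons]
    push_cast at this; linarith
  have h6 : 0 ≤ leadEffort h Xbar ((1 + a) :: L) :=
    (eff_pos hS hT.of_cons ⟨root_le_root_cons hS hT, root_lt hS hT⟩).le
  have h7 : root h Xbar (a :: L) ≤ root h Xbar ((1 + a) :: L) :=
    root_cons_le hS hT'.of_cons (root_le_root_cons hS hT) (h4 ▸ h6)
  rw [← h4, ← h5]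
  exact resp_strictMonoOn hS hT'.of_cons ⟨h7, (root_lt hS hT).le⟩
    ⟨h7.trans h3.le, (root_lt hS hT').le⟩ h3

theorem exists_split (hn : 0 < n) {c : Composition n} (hc : ¬ IsSingleLeader c) :
    ∃ (c' : Composition n) (a : ℕ) (L : List ℕ), c.blocks = (1 + a) :: L ∧
      c'.blocks = 1 :: a :: L := by
  rcases hb : c.blocks with _ | ⟨m, L⟩
  · rw [c.blocks_eq_nil] at hb; omega
  have hT := isTail_blocks c
  have hsum := c.blocks_sum
  rw [hb] at hT hsum
  have hm := hT.1 m (by simp)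
  have hm1 : m ≠ 1 := by
    rintro rfl; exact hc (by simp [IsSingleLeader, hb])
  refine ⟨⟨1 :: (m - 1) :: L, ?_, ?_⟩, m - 1, L, ?_, rfl⟩
  · intro i hi
    simp only [List.mem_cons] at hi
    rcases hi with rfl | rfl | hi
    · exact one_pos
    · omega
    · exact hT.1 i (by simp [hi])
  · simp at hsum ⊢; omega
  · congr 1; omega

theorem isSingleLeader_of_maximizes (hS : StandingAssumptions h Xbar n) (hn : 0 < n)
    {c : Composition n} (hc : MaximizesHighestEffort h c) : IsSingleLeader c := by
  by_contra h1
  obtain ⟨c', a, L, h2, h3⟩ := exists_split hn h1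
  exact absurd (leadEffort_split hS h2 h3) (not_lt.2 ((maximizes_iff hS hn).1 hc c'))

/-- Every contest is dominated by one with a single leader. -/
theorem exists_singleLeader (hS : StandingAssumptions h Xbar n) (hn : 0 < n)
    (c : Composition n) : ∃ c' : Composition n, IsSingleLeader c' ∧ c'.length ≤ c.length + 1 ∧
      leadEffort h Xbar c.blocks ≤ leadEffort h Xbar c'.blocks := by
  by_cases h1 : IsSingleLeader c
  · exact ⟨c, h1, by omega, le_rfl⟩
  · obtain ⟨c', a, L, h2, h3⟩ := exists_split hn h1
    refine ⟨c', by simp [IsSingleLeader, h3], ?_, (leadEffort_split hS h2 h3).le⟩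
    rw [← c.blocks_length, ← c'.blocks_length, h2, h3]; simp

theorem blocks_eq_one_cons {c : Composition n} (hc : IsSingleLeader c) :
    ∃ L, c.blocks = 1 :: L := by
  rw [IsSingleLeader] at hc
  rcases hb : c.blocks with _ | ⟨m, L⟩
  · simp [hb] at hc
  · exact ⟨L, by simpa [hb] using hc⟩

/-- The effort of a single leader in terms of the inverted best response of the followers. -/
theorem leadEffort_eq_resp (hS : StandingAssumptions h Xbar n) {L : List ℕ}
    (hL : IsTail n (1 :: L)) :
    leadEffort h Xbar (1 :: L) = resp h Xbar L (root h Xbar (1 :: L)) := by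
  have := resp_root hS hL
  rw [resp_cons] at this
  rw [leadEffort, List.tail_cons]
  push_cast at this; linarith

/-- Adds two expressions for the leader's effort: `eff L`, from optimality, and `resp L`, because a
single leader's effort is the whole cumulative effort seen by the followers. -/
theorem two_mul_leadEffort_sub (hS : StandingAssumptions h Xbar n) {L : List ℕ}
    (hL : IsTail n (1 :: L)) :
    2 * leadEffort h Xbar (1 :: L) - root h Xbar (1 :: L) =
      gFun h Xbar (root h Xbar (1 :: L)) + ∑ k ∈ Finset.range L.length, (esym L (k + 1) : ℝ) *
        (gTerm h Xbar (k + 1) (root h Xbar (1 :: L)) -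
          gTerm h Xbar k (root h Xbar (1 :: L))) := by
  have h1 := leadEffort_eq_resp hS hL
  have h2 : leadEffort h Xbar (1 :: L) = eff h Xbar L (root h Xbar (1 :: L)) := rfl
  rw [eff, Finset.sum_range_succ', esym_zero] at h2
  rw [resp] at h1
  simp only [mul_sub, Finset.sum_sub_distrib]
  simp only [Nat.cast_one, one_mul, gTerm] at h2 ⊢
  linarith

/-! ### Linear marginal benefit -/

/-- With linear marginal benefits all functions `g_k` coincide. -/
theorem gTerm_linear (hS : StandingAssumptions h Xbar n)
    (hlin : ∃ a b : ℝ, ∀ X ∈ Icc 0 Xbar, h X = a * X + b) (k : ℕ) {X : ℝ}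
    (hX : X ∈ Icc 0 Xbar) : gTerm h Xbar k X = Xbar - X := by
  obtain ⟨a, b, hab⟩ := hlin
  have hg : ∀ X ∈ Icc 0 Xbar, gFun h Xbar X = Xbar - X := by
    intro X hX
    have h1 : HasDerivWithinAt h a (Icc 0 Xbar) X := by
      have : HasDerivWithinAt (fun X => a * X + b) a (Icc 0 Xbar) X := by
        simpa using ((hasDerivWithinAt_id X (Icc 0 Xbar)).const_mul a).add_const b
      exact this.congr hab (hab X hX)
    have h2 := h1.derivWithin (uniqueDiff hS X hX)
    have h3 := hS.deriv_neg X hX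
    have h4 := hab Xbar (right_mem_Icc.2 hS.saturation_pos.le)
    rw [hS.saturation] at h4
    rw [gFun, h2, hab X hX]
    rw [h2] at h3
    rw [show a * X + b = (X - Xbar) * a by linarith, neg_div, mul_div_cancel_right₀ _ h3.ne]
    ring
  induction k generalizing X with
  | zero => exact hg X hX
  | succ k ih =>
    have h1 : HasDerivWithinAt (gTerm h Xbar k) (-1) (Icc 0 Xbar) X :=
      ((hasDerivWithinAt_id X (Icc 0 Xbar)).const_sub Xbar).congr (fun Y hY => ih hY) (ih hX)
    simp only [gTerm]
    rw [h1.derivWithin (uniqueDiff hS X hX), hg X hX]; ring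

theorem leadEffort_linear (hS : StandingAssumptions h Xbar n)
    (hlin : ∃ a b : ℝ, ∀ X ∈ Icc 0 Xbar, h X = a * X + b) {c : Composition n}
    (hc : IsSingleLeader c) : leadEffort h Xbar c.blocks = Xbar / 2 := by
  obtain ⟨L, hL⟩ := blocks_eq_one_cons hc
  have hT := isTail_blocks c
  rw [hL] at hT ⊢
  have hX := Ico_subset_Icc_self (root_mem hS hT)
  have h1 := two_mul_leadEffort_sub hS hT
  have h2 : gFun h Xbar (root h Xbar (1 :: L)) = Xbar - root h Xbar (1 :: L) :=
    gTerm_linear hS hlin 0 hX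
  simp only [gTerm_linear hS hlin _ hX, h2, sub_self, mul_zero, Finset.sum_const_zero] at h1
  linarith

theorem maximizes_of_linear (hS : StandingAssumptions h Xbar n) (hn : 0 < n)
    (hlin : ∃ a b : ℝ, ∀ X ∈ Icc 0 Xbar, h X = a * X + b) {c : Composition n}
    (hc : IsSingleLeader c) : MaximizesHighestEffort h c := by
  rw [maximizes_iff hS hn]
  intro c'
  obtain ⟨c'', h1, -, h2⟩ := exists_singleLeader hS hn c'
  rwa [leadEffort_linear hS hlin h1, ← leadEffort_linear hS hlin hc] at h2

/-! ## Large contests -/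

theorem exists_Ico_of_eventually (hX : 0 < Xbar) {P : ℝ → Prop}
    (hP : ∀ᶠ X in nhdsWithin Xbar (Icc 0 Xbar), P X) :
    ∃ X₀ ∈ Ico 0 Xbar, ∀ X ∈ Icc X₀ Xbar, P X := by
  obtain ⟨δ, hδ, h1⟩ := Metric.mem_nhdsWithin_iff.1 hP
  refine ⟨max 0 (Xbar - δ / 2), ⟨le_max_left _ _, max_lt hX (by linarith)⟩, fun X h2 => ?_⟩
  have h3 := (le_max_left _ _).trans h2.1
  have h4 := (le_max_right _ _).trans h2.1
  refine h1 ⟨?_, h3, h2.2⟩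
  rw [Metric.mem_ball, Real.dist_eq, abs_lt]
  constructor <;> linarith [h2.2]

/-- In large contests the total effort is close to the saturation point. -/
theorem eventually_root {n₀ : ℕ} (hS : ∀ n, n₀ ≤ n → StandingAssumptions h Xbar n) {P : ℝ → Prop}
    (hP : ∀ᶠ X in nhdsWithin Xbar (Icc 0 Xbar), P X) :
    ∃ N, ∀ n, N ≤ n → ∀ c : Composition n, P (root h Xbar c.blocks) := by
  have hX := (hS n₀ le_rfl).saturation_pos
  obtain ⟨X₀, hX₀, hP⟩ := exists_Ico_of_eventually hX hP
  have hg := gFun_pos (hS n₀ le_rfl) hX₀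
  obtain ⟨N, hN⟩ := exists_nat_ge (X₀ / gFun h Xbar X₀)
  refine ⟨max N (max n₀ 1), fun n hn c => ?_⟩
  have hn0 : 0 < n := by omega
  have hSn := hS n (by omega)
  -- Once `n g(X₀) ≥ X₀`, the simultaneous total lies above `X₀`, and every other total is at least
  -- as large.
  have h1 : X₀ ≤ root h Xbar [n] := by
    refine le_root hSn (isTail_single hn0) hX₀.2.le ?_
    rw [resp_single, sub_nonpos, ← div_le_iff₀ hg]
    exact hN.trans (by exact_mod_cast (by omega : N ≤ n))
  exact hP _ ⟨h1.trans (root_single_le hSn hn0 c), (root_lt hSn (isTail_blocks c)).le⟩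

/-- At `Xbar` both `h` and `g` vanish, so second-derivative terms drop out and the slope of `-g_k'
g` is `-(-1)(-1)`. -/
theorem hasDerivWithinAt_gTerm_Xbar (hS : StandingAssumptions h Xbar n) {k : ℕ} (hk : k < n) :
    HasDerivWithinAt (gTerm h Xbar k) (-1) (Icc 0 Xbar) Xbar := by
  have hX : Xbar ∈ Icc 0 Xbar := right_mem_Icc.2 hS.saturation_pos.le
  have h0 : HasDerivWithinAt (gFun h Xbar) (-1) (Icc 0 Xbar) Xbar := by
    have h1 : DifferentiableOn ℝ (derivWithin h (Icc 0 Xbar)) (Icc 0 Xbar) :=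
      (hS.contDiff.derivWithin (m := 1) (uniqueDiff hS)
        (by exact_mod_cast (by omega : 1 + 1 ≤ n + 1))).differentiableOn (by simp)
    have h3 := (hS.deriv_neg Xbar hX).ne
    refine ((hasDerivWithinAt_h hS hX).fun_neg.fun_div (h1 Xbar hX).hasDerivWithinAt
      h3).congr_deriv ?_
    rw [hS.saturation]
    field_simp
    simp
  induction k with
  | zero => exact h0
  | succ k ih =>
    have h1 := ih (by omega)
    have h2 : DifferentiableOn ℝ (derivWithin (gTerm h Xbar k) (Icc 0 Xbar)) (Icc 0 Xbar) :=
      ((contDiffOn_gTerm hS (k := k) (m := 2) (by omega)).derivWithin (m := 1) (uniqueDiff hS)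
        (by norm_num)).differentiableOn (by simp)
    refine ((h2 Xbar hX).hasDerivWithinAt.fun_neg.fun_mul h0).congr_deriv ?_
    rw [h1.derivWithin (uniqueDiff hS Xbar hX), gFun_Xbar hS]
    ring

theorem eventually_gTerm (hS : StandingAssumptions h Xbar n) {k : ℕ} (hk : k < n) {η : ℝ}
    (hη : 0 < η) : ∀ᶠ X in nhdsWithin Xbar (Icc 0 Xbar),
      |gTerm h Xbar k X - (Xbar - X)| ≤ η * (Xbar - X) := by
  have h1 := (hasDerivWithinAt_gTerm_Xbar hS hk).isLittleO.def hη
  filter_upwards [h1, self_mem_nhdsWithin] with X h2 h3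
  rw [gTerm_Xbar hS, Real.norm_eq_abs, Real.norm_eq_abs, abs_of_nonpos (sub_nonpos.2 h3.2)] at h2
  simp only [smul_eq_mul] at h2
  convert h2 using 2 <;> ring

/-- Single leaders of large contests with boundedly many periods exert about half of the
saturation effort. -/
theorem leadEffort_near_half {n₀ : ℕ} (hS : ∀ n, n₀ ≤ n → StandingAssumptions h Xbar n) (T : ℕ)
    {ε : ℝ} (hε : 0 < ε) : ∃ N, ∀ n, N ≤ n → ∀ c : Composition n, c.length ≤ T →
      IsSingleLeader c → |leadEffort h Xbar c.blocks - Xbar / 2| ≤ ε := by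
  have hX := (hS n₀ le_rfl).saturation_pos
  set δ := ε / Xbar with hδ
  have hδ0 : 0 < δ := by positivity
  -- Chosen so that `2η = δ(1 - η)`: if each `g_k` is within relative error `η` of `Xbar - X`, then
  -- `g_{k+1} - g_k` is at most `δ g_k`.
  set η := δ / (2 + δ) with hη
  have hη0 : 0 < η := by positivity
  have hη1 : 2 * η = δ * (1 - η) := by rw [hη]; field_simp; ring
  have hη2 : η < 1 := by rw [hη, div_lt_one (by positivity)]; linarith
  have hA : ∀ᶠ X in nhdsWithin Xbar (Icc 0 Xbar), ∀ k ∈ Finset.range (T + 1),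
      |gTerm h Xbar k X - (Xbar - X)| ≤ η * (Xbar - X) :=
    (Finset.eventually_all _).2 fun k hk =>
      eventually_gTerm (hS (n₀ + T + 1) (by omega)) (by have := Finset.mem_range.1 hk; omega) hη0
  have hB : ∀ᶠ X in nhdsWithin Xbar (Icc 0 Xbar), Xbar - X < ε / 3 :=
    nhdsWithin_le_nhds (((continuous_const.sub continuous_id).tendsto Xbar).eventually_lt_const
      (by simpa using hε))
  obtain ⟨N, hN⟩ := eventually_root hS (hA.and hB)
  refine ⟨max N n₀, fun n hn c hcT hc => ?_⟩
  have hSn := hS n (by omega)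
  obtain ⟨h1, h2⟩ := hN n (by omega) c
  have hT := isTail_blocks c
  have hlen := c.blocks_length
  obtain ⟨L, hL⟩ := blocks_eq_one_cons hc
  rw [hL] at h1 h2 hT hlen ⊢
  rw [List.length_cons] at hlen
  have h3 := two_mul_leadEffort_sub hSn hT
  have h4 := leadEffort_eq_resp hSn hT
  have h5 : 0 < leadEffort h Xbar (1 :: L) :=
    eff_pos hSn hT.of_cons ⟨root_le_root_cons hSn hT, root_lt hSn hT⟩
  have h6 := root_lt hSn hT
  set X := root h Xbar (1 :: L)
  set x := leadEffort h Xbar (1 :: L)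
  rw [resp] at h4
  have h7 : ∀ k ∈ Finset.range L.length,
      |gTerm h Xbar (k + 1) X - gTerm h Xbar k X| ≤ δ * gTerm h Xbar k X := by
    intro k hk
    have hk := Finset.mem_range.1 hk
    have h8 := abs_le.1 (h1 k (Finset.mem_range.2 (by omega)))
    have h9 := abs_le.1 (h1 (k + 1) (Finset.mem_range.2 (by omega)))
    have h10 : δ * ((1 - η) * (Xbar - X)) ≤ δ * gTerm h Xbar k X :=
      mul_le_mul_of_nonneg_left (by linarith) hδ0.le
    have h11 : δ * ((1 - η) * (Xbar - X)) = 2 * (η * (Xbar - X)) := by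
      rw [← mul_assoc, ← hη1]; ring
    rw [abs_le]
    constructor <;> linarith
  -- The unbounded weights `S_k` are harmless: `∑ S_k g_k = X - x`, which is less than `Xbar`.
  have h8 : |∑ k ∈ Finset.range L.length, (esym L (k + 1) : ℝ) *
      (gTerm h Xbar (k + 1) X - gTerm h Xbar k X)| ≤ δ * (X - x) := by
    rw [h4, sub_sub_cancel, Finset.mul_sum]
    refine (Finset.abs_sum_le_sum_abs _ _).trans (Finset.sum_le_sum fun k hk => ?_)
    rw [abs_mul, Nat.abs_cast, mul_left_comm]
    exact mul_le_mul_of_nonneg_left (h7 k hk) (Nat.cast_nonneg _)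
  have h9 : δ * (X - x) ≤ ε := by
    calc δ * (X - x) ≤ δ * Xbar := mul_le_mul_of_nonneg_left (by linarith) hδ0.le
      _ = ε := by rw [hδ]; field_simp
  have h10 : |gFun h Xbar X - (Xbar - X)| ≤ η * (Xbar - X) :=
    h1 0 (Finset.mem_range.2 (by omega))
  have h11 : η * (Xbar - X) ≤ 1 * (Xbar - X) :=
    mul_le_mul_of_nonneg_right hη2.le (by linarith)
  rw [abs_le] at h8 h10 ⊢
  constructor <;> linarith

/-- The bound `T + 1` leaves room for the period added when a leader is split off the competitor. -/
theorem le_add_of_near_half {T : ℕ} {ε m m' : ℝ} (hS : StandingAssumptions h Xbar n) (hn : 0 < n)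
    (hnear : ∀ c : Composition n, c.length ≤ T + 1 → IsSingleLeader c →
      |leadEffort h Xbar c.blocks - Xbar / 2| ≤ ε / 2)
    {c c' : Composition n} (hcT : c.length ≤ T) (hcT' : c'.length ≤ T) (hc : IsSingleLeader c)
    (hm : IsHighestEffort h c m) (hm' : IsHighestEffort h c' m') : m' ≤ m + ε := by
  rw [isHighestEffort_iff hS hn] at hm hm'
  obtain ⟨c'', h1, h2, h3⟩ := exists_singleLeader hS hn c'
  have h4 := abs_le.1 (hnear c (by omega) hc)
  have h5 := abs_le.1 (hnear c'' (by omega) h1)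
  rw [hm, hm']; linarith

/-! ## Power series -/

/-- The power series with coefficients `b` converges absolutely on the disc of radius `ρ`. -/
def ConvergesOn (b : ℕ → ℝ) (ρ : ℝ) : Prop :=
  ∀ s, 0 ≤ s → s < ρ → Summable fun j => |b j| * s ^ j

theorem ConvergesOn.summable {b : ℕ → ℝ} {ρ u : ℝ} (hb : ConvergesOn b ρ) (hu : |u| < ρ) :
    Summable fun j => b j * u ^ j := by
  refine Summable.of_norm ?_
  simpa [abs_mul, abs_pow] using hb |u| (abs_nonneg u) hu

theorem ConvergesOn.exists_bound {b : ℕ → ℝ} {ρ s : ℝ} (hb : ConvergesOn b ρ) (hs : 0 ≤ s)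
    (hsρ : s < ρ) : ∃ B, 0 ≤ B ∧ ∀ j, |b j| * s ^ j ≤ B := by
  refine ⟨∑' j, |b j| * s ^ j, tsum_nonneg fun j => by positivity, fun j => ?_⟩
  exact (hb s hs hsρ).le_tsum j fun k _ => by positivity

theorem ConvergesOn.nat_mul {b : ℕ → ℝ} {ρ : ℝ} (hb : ConvergesOn b ρ) :
    ConvergesOn (fun j => j * b j) ρ := by
  intro s hs hsρ
  obtain ⟨r, h1, h3⟩ := exists_between hsρ
  have h0 : 0 < r := hs.trans_lt h1
  obtain ⟨B, -, hB⟩ := hb.exists_bound h0.le h3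
  have h2 : ‖s / r‖ < 1 := by
    rw [Real.norm_of_nonneg (by positivity), div_lt_one h0]; exact h1
  refine Summable.of_nonneg_of_le (fun j => by positivity) (fun j => ?_)
    ((summable_pow_mul_geometric_of_norm_lt_one 1 h2).mul_left B)
  calc |(j : ℝ) * b j| * s ^ j = (|b j| * r ^ j) * ((j : ℝ) ^ 1 * (s / r) ^ j) := by
        rw [abs_mul, Nat.abs_cast, div_pow]; field_simp
    _ ≤ B * ((j : ℝ) ^ 1 * (s / r) ^ j) :=
        mul_le_mul_of_nonneg_right (hB j) (by positivity)

theorem ConvergesOn.linear_mul {b : ℕ → ℝ} {ρ : ℝ} (hb : ConvergesOn b ρ) (a : ℝ) :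
    ConvergesOn (fun j => (1 + j * a) * b j) ρ := by
  intro s hs hsρ
  refine Summable.of_nonneg_of_le (fun j => by positivity) (fun j => ?_)
    ((hb s hs hsρ).add ((hb.nat_mul s hs hsρ).mul_left |a|))
  calc |(1 + j * a) * b j| * s ^ j = |b j + a * (j * b j)| * s ^ j := by congr 2; ring
    _ ≤ (|b j| + |a * (j * b j)|) * s ^ j :=
        mul_le_mul_of_nonneg_right (abs_add_le _ _) (by positivity)
    _ = _ := by rw [abs_mul a]; ring

theorem ConvergesOn.hasDerivAt {b : ℕ → ℝ} {ρ u : ℝ} (hb : ConvergesOn b ρ) (hu : |u| < ρ) :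
    HasDerivAt (fun v => ∑' j, b j * v ^ j) (∑' j : ℕ, b j * ((j : ℝ) * u ^ (j - 1))) u := by
  obtain ⟨s, h1, h2⟩ := exists_between hu
  have h0 : 0 < s := (abs_nonneg u).trans_lt h1
  have hsum : Summable fun j : ℕ => s⁻¹ * (|(j : ℝ) * b j| * s ^ j) :=
    (hb.nat_mul s h0.le h2).mul_left _
  have hu' : u ∈ Metric.ball (0 : ℝ) s := by simpa using h1
  have hbound : ∀ (j : ℕ) (v : ℝ), v ∈ Metric.ball (0 : ℝ) s →
      ‖b j * ((j : ℝ) * v ^ (j - 1))‖ ≤ s⁻¹ * (|(j : ℝ) * b j| * s ^ j) := by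
    intro j v hv
    have hv : |v| < s := by simpa using hv
    cases j with
    | zero => simp
    | succ j =>
      have h3 : |v| ^ j ≤ s ^ j := pow_le_pow_left₀ (abs_nonneg v) hv.le j
      rw [add_tsub_cancel_right, Real.norm_eq_abs, ← mul_assoc, abs_mul, abs_pow, pow_succ,
        mul_comm (b (j + 1))]
      calc |((j + 1 : ℕ) : ℝ) * b (j + 1)| * |v| ^ j
          ≤ |((j + 1 : ℕ) : ℝ) * b (j + 1)| * s ^ j :=
            mul_le_mul_of_nonneg_left h3 (abs_nonneg _)
        _ = s⁻¹ * s * (|((j + 1 : ℕ) : ℝ) * b (j + 1)| * s ^ j) := by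
            rw [inv_mul_cancel₀ h0.ne', one_mul]
        _ = _ := by ring
  exact hasDerivAt_tsum_of_isPreconnected hsum Metric.isOpen_ball
    (convex_ball _ _).isPreconnected (fun j v _ => (hasDerivAt_pow j v).const_mul (b j))
    hbound hu' (hb.summable hu) hu'

theorem exists_analyticAt_leftInverse {H : ℝ → ℝ} {a : ℝ} (hH : AnalyticAt ℝ H a)
    (hd : deriv H a ≠ 0) : ∃ ψ : ℝ → ℝ, AnalyticAt ℝ ψ (H a) ∧ ∀ᶠ x in nhds a, ψ (H x) = x := by
  have h1 := hH.hasStrictDerivAt.hasStrictFDerivAt_equiv hd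
  set f := h1.toOpenPartialHomeomorph H
  have hs : a ∈ f.source := h1.mem_toOpenPartialHomeomorph_source
  have hf : (f : ℝ → ℝ) = H := h1.toOpenPartialHomeomorph_coe
  refine ⟨f.symm, ?_, ?_⟩
  · rw [← hf]
    exact f.analyticAt_symm' hs (by rwa [hf]) (by rw [hf]; exact h1.hasFDerivAt.fderiv)
  · filter_upwards [f.open_source.mem_nhds hs] with x hx
    rw [← hf]
    exact f.left_inv hx

theorem exists_convergesOn_of_analyticAt {ψ : ℝ → ℝ} (hψ : AnalyticAt ℝ ψ 0) :
    ∃ (b : ℕ → ℝ) (ρ : ℝ), 0 < ρ ∧ ConvergesOn b ρ ∧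
      ∀ u, |u| < ρ → HasSum (fun j => b j * u ^ j) (ψ u) := by
  obtain ⟨p, r, hp⟩ := hψ
  obtain ⟨ρ, hρ0, hρr⟩ := ENNReal.lt_iff_exists_nnreal_btwn.1 hp.r_pos
  refine ⟨p.coeff, ρ, by exact_mod_cast hρ0, fun s hs hsρ => ?_, fun u hu => ?_⟩
  · lift s to NNReal using hs
    have h1 : (s : ENNReal) < p.radius := by
      refine lt_of_lt_of_le ?_ (hρr.le.trans hp.r_le)
      exact_mod_cast hsρ
    have := p.summable_norm_mul_pow h1
    simpa [p.norm_apply_eq_norm_coef, Real.norm_eq_abs] using this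
  · have h2 : u ∈ Metric.eball (0 : ℝ) r := by
      refine Metric.eball_subset_eball hρr.le ?_
      rw [Metric.mem_eball, edist_dist, Real.dist_eq, sub_zero, ENNReal.ofReal_lt_coe_iff
        (abs_nonneg u)]
      exact hu
    have := hp.hasSum h2
    simpa [p.apply_eq_pow_smul_coeff, mul_comm] using this

/-- If `h` is analytic at the saturation point, then total effort is a power series in `h`. -/
theorem exists_series (hS : StandingAssumptions h Xbar n)
    (ha : AnalyticWithinAt ℝ h (Icc 0 Xbar) Xbar) :
    ∃ (b : ℕ → ℝ) (ρ : ℝ), 0 < ρ ∧ ConvergesOn b ρ ∧ b 0 = Xbar ∧ b 1 < 0 ∧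
      ∀ᶠ X in nhdsWithin Xbar (Icc 0 Xbar), |h X| < ρ ∧ ∑' j, b j * h X ^ j = X := by
  have hX : Xbar ∈ Icc 0 Xbar := right_mem_Icc.2 hS.saturation_pos.le
  obtain ⟨H, hHX, hH, hHa⟩ := ha.exists_analyticAt
  rw [insert_eq_of_mem hX] at hH
  have h1 := hasDerivWithinAt_h hS hX
  have h2 : derivWithin h (Icc 0 Xbar) Xbar = deriv H Xbar :=
    (hHa.differentiableAt.hasDerivAt.hasDerivWithinAt.congr hH hHX).derivWithin
      (uniqueDiff hS Xbar hX)
  have h3 := hS.deriv_neg Xbar hX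
  obtain ⟨ψ, hψ, hψH⟩ := exists_analyticAt_leftInverse hHa (h2 ▸ h3.ne)
  rw [← hHX, hS.saturation] at hψ
  obtain ⟨b, ρ, hρ, hb, hsum⟩ := exists_convergesOn_of_analyticAt hψ
  have hev : ∀ᶠ X in nhdsWithin Xbar (Icc 0 Xbar), |h X| < ρ ∧ ∑' j, b j * h X ^ j = X := by
    have h4 : ∀ᶠ X in nhdsWithin Xbar (Icc 0 Xbar), |h X| < ρ := by
      have := h1.continuousWithinAt.abs
      rw [ContinuousWithinAt, hS.saturation, abs_zero] at this
      exact this.eventually_lt_const hρ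
    filter_upwards [h4, self_mem_nhdsWithin, nhdsWithin_le_nhds hψH] with X h5 h6 h7
    refine ⟨h5, ?_⟩
    rw [(hsum _ h5).tsum_eq, hH h6, h7]
  have hev0 := hev.self_of_nhdsWithin hX
  have hb0 : b 0 = Xbar := by
    have := hev0.2
    rw [hS.saturation, tsum_eq_single 0 (by intro j hj; simp [hj])] at this
    simpa using this
  refine ⟨b, ρ, hρ, hb, hb0, ?_, hev⟩
  have h5 := hb.hasDerivAt (u := h Xbar) (by simpa [hS.saturation] using hρ)
  rw [hS.saturation, tsum_eq_single 1 (by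
    intro j hj
    rcases Nat.lt_or_ge j 2 with h6 | h6
    · obtain rfl : j = 0 := by omega
      simp
    · simp [show j - 1 ≠ 0 by omega])] at h5
  simp only [Nat.cast_one, tsub_self, pow_zero, mul_one] at h5
  -- Differentiating `∑ b_j h^j = X` at `Xbar` gives `b_1 h'(Xbar) = 1`, hence `b_1 < 0`.
  have h6 : HasDerivWithinAt (fun X => ∑' j, b j * h X ^ j)
      (b 1 * derivWithin h (Icc 0 Xbar) Xbar) (Icc 0 Xbar) Xbar := by
    rw [← hS.saturation] at h5
    exact h5.comp_hasDerivWithinAt Xbar h1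
  have h7 : HasDerivWithinAt (fun X => ∑' j, b j * h X ^ j) 1 (Icc 0 Xbar) Xbar :=
    (hasDerivWithinAt_id Xbar _).congr_of_eventuallyEq (hev.mono fun X h8 => h8.2) hev0.2
  have h8 := (uniqueDiff hS Xbar hX).eq_deriv _ h6 h7
  by_contra! h9
  have := mul_nonpos_of_nonneg_of_nonpos h9 h3.le
  linarith

/-- The factor `∏ (1 + j n_t)` by which the `j`-th coefficient is multiplied. -/
noncomputable def factor (L : List ℕ) (j : ℕ) : ℝ := (L.map fun m : ℕ => (1 + j * m : ℝ)).prod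

theorem factor_cons (m : ℕ) (L : List ℕ) (j : ℕ) :
    factor (m :: L) j = (1 + j * m) * factor L j := by simp [factor]

theorem ConvergesOn.factor_mul {b : ℕ → ℝ} {ρ : ℝ} (hb : ConvergesOn b ρ) (L : List ℕ) :
    ConvergesOn (fun j => factor L j * b j) ρ := by
  induction L with
  | nil => simpa [factor] using hb
  | cons m L ih =>
    have := ih.linear_mul m
    simpa only [factor_cons, mul_assoc] using this

/-- By the chain rule `eff L = -u d(resp L)/du` with `u = h X`, so `resp_cons` acts on series as `1
+ m u d/du`. The interval is open at `X₀` so that the induction hypothesis holds near `X` and can be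
differentiated. -/
theorem resp_eq_tsum (hS : StandingAssumptions h Xbar n) {b : ℕ → ℝ} {ρ X₀ : ℝ}
    (hX₀ : X₀ ∈ Ico 0 Xbar) (hb : ConvergesOn b ρ)
    (hser : ∀ X ∈ Icc X₀ Xbar, |h X| < ρ ∧ ∑' j, b j * h X ^ j = X) {L : List ℕ}
    (hL : IsTail n L) {X : ℝ} (hX : X ∈ Ioc X₀ Xbar) :
    resp h Xbar L X = ∑' j, factor L j * b j * h X ^ j := by
  induction L generalizing X with
  | nil => simpa [factor] using (hser X (Ioc_subset_Icc_self hX)).2.symm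
  | cons m L ih =>
    have hXI : X ∈ Icc 0 Xbar := ⟨hX₀.1.trans hX.1.le, hX.2⟩
    have hρ := (hser X (Ioc_subset_Icc_self hX)).1
    have hbL := hb.factor_mul L
    obtain ⟨h1, h2⟩ := hasDerivWithinAt_resp hS hL.of_cons.length_le hXI
    have h3 : HasDerivWithinAt (resp h Xbar L)
        ((∑' j, factor L j * b j * (j * h X ^ (j - 1))) * derivWithin h (Icc 0 Xbar) X)
        (Icc 0 Xbar) X := by
      refine HasDerivWithinAt.congr_of_eventuallyEq
        ((hbL.hasDerivAt hρ).comp_hasDerivWithinAt X (hasDerivWithinAt_h hS hXI)) ?_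
        (ih hL.of_cons hX)
      filter_upwards [self_mem_nhdsWithin, nhdsWithin_le_nhds (lt_mem_nhds hX.1)] with Y h4 h5
      exact ih hL.of_cons ⟨h5, h4.2⟩
    have h4 : eff h Xbar L X = - ∑' j, j * (factor L j * b j) * h X ^ j := by
      rw [← h2, h3.derivWithin (uniqueDiff hS X hXI), mul_assoc, gFun,
        mul_div_cancel₀ _ (hS.deriv_neg X hXI).ne, mul_neg, ← tsum_mul_right]
      congr 1
      refine tsum_congr fun j => ?_
      cases j with
      | zero => simp
      | succ j => rw [add_tsub_cancel_right, pow_succ]; ring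
    rw [resp_cons, ih hL.of_cons hX, h4, mul_neg, sub_neg_eq_add, ← tsum_mul_left,
      ← (hbL.summable hρ).tsum_add ((hbL.nat_mul.summable hρ).mul_left _)]
    refine tsum_congr fun j => ?_
    rw [factor_cons]; ring

/-! ## Bounds for the factors -/

/-- The ratio of the second factor to the square of the first one. -/
noncomputable def ratio (L : List ℕ) : ℝ :=
  (L.map fun m : ℕ => ((1 + 2 * m) / (1 + m) ^ 2 : ℝ)).prod

theorem factor_nonneg (L : List ℕ) (j : ℕ) : 0 ≤ factor L j :=
  List.prod_nonneg fun x hx => by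
    obtain ⟨m, -, rfl⟩ := List.mem_map.1 hx; positivity

theorem ratio_nonneg (L : List ℕ) : 0 ≤ ratio L :=
  List.prod_nonneg fun x hx => by
    obtain ⟨m, -, rfl⟩ := List.mem_map.1 hx; positivity

theorem one_add_sum_le_factor (L : List ℕ) : 1 + (L.sum : ℝ) ≤ factor L 1 := by
  induction L with
  | nil => simp [factor]
  | cons m L ih =>
    rw [factor_cons, List.sum_cons]
    have h1 : (0 : ℝ) ≤ L.sum := Nat.cast_nonneg _
    have h2 : (0 : ℝ) ≤ m := Nat.cast_nonneg _
    calc 1 + ((m + L.sum : ℕ) : ℝ) ≤ (1 + (1 : ℕ) * m) * (1 + L.sum) := by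
          rw [Nat.cast_add, Nat.cast_one]; nlinarith [mul_nonneg h1 h2]
      _ ≤ _ := mul_le_mul_of_nonneg_left ih (by positivity)

/-- Blockwise Bernoulli: `1 + (i+1)m = (1+m)(1 + i m/(1+m)) ≤ (1+m)(1 + m/(1+m))^i`. -/
theorem factor_succ_le (L : List ℕ) (i : ℕ) :
    factor L (i + 1) ≤ factor L 1 ^ (i + 1) * ratio L ^ i := by
  induction L with
  | nil => simp [factor, ratio]
  | cons m L ih =>
    have h1 : (1 + ((i + 1 : ℕ) : ℝ) * m) ≤
        (1 + ((1 : ℕ) : ℝ) * m) ^ (i + 1) * ((1 + 2 * m) / (1 + m) ^ 2 : ℝ) ^ i := by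
      have hm : (0 : ℝ) < 1 + m := by positivity
      have h2 : (1 + ((1 : ℕ) : ℝ) * m) ^ (i + 1) * ((1 + 2 * m) / (1 + m) ^ 2 : ℝ) ^ i =
          (1 + m) * (1 + (m / (1 + m) : ℝ)) ^ i := by
        have h3 : (1 + (m / (1 + m) : ℝ)) = (1 + m) * ((1 + 2 * m) / (1 + m) ^ 2) := by
          field_simp; ring
        rw [h3, mul_pow]; push_cast; ring
      rw [h2]
      have h4 : (0 : ℝ) ≤ m / (1 + m) := by positivity
      have h5 := one_add_mul_le_pow (show (-2 : ℝ) ≤ m / (1 + m) by linarith) i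
      calc (1 + ((i + 1 : ℕ) : ℝ) * m) = (1 + m) * (1 + i * (m / (1 + m))) := by
            field_simp; push_cast; ring
        _ ≤ _ := mul_le_mul_of_nonneg_left h5 hm.le
    have h2 : ratio (m :: L) = (1 + 2 * m) / (1 + m) ^ 2 * ratio L := by simp [ratio]
    rw [factor_cons, factor_cons, h2, mul_pow, mul_pow, mul_mul_mul_comm]
    exact mul_le_mul h1 ih (factor_nonneg _ _) (by positivity)

/-- Blockwise this is `(1+2m)^3 ≤ (1+m)^5`. The exponent 3 is needed: the square already fails at `m
= 1`. Since `factor L 1` exceeds the number of players, `ratio` tends to zero uniformly. -/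
theorem ratio_pow_three_mul_le {L : List ℕ} (hL : ∀ m ∈ L, 0 < m) :
    ratio L ^ 3 * factor L 1 ≤ 1 := by
  induction L with
  | nil => simp [factor, ratio]
  | cons m L ih =>
    have h2 : ratio (m :: L) = (1 + 2 * m) / (1 + m) ^ 2 * ratio L := by simp [ratio]
    have hm : (1 : ℝ) ≤ m := by exact_mod_cast hL m (by simp)
    rw [factor_cons, h2, mul_pow, mul_mul_mul_comm]
    refine mul_le_one₀ ?_ (mul_nonneg (pow_nonneg (ratio_nonneg L) 3) (factor_nonneg L 1))
      (ih fun k hk => hL k (by simp [hk]))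
    have h3 : ((1 + 2 * m) / (1 + m) ^ 2 : ℝ) ^ 3 * (1 + ((1 : ℕ) : ℝ) * m) =
        (1 + 2 * m) ^ 3 / (1 + m) ^ 5 := by
      push_cast; field_simp
    rw [h3, div_le_one (by positivity)]
    nlinarith [pow_le_pow_left₀ zero_le_one hm 2, pow_le_pow_left₀ zero_le_one hm 3,
      pow_le_pow_left₀ zero_le_one hm 4, pow_le_pow_left₀ zero_le_one hm 5,
      mul_le_mul_of_nonneg_left hm (sq_nonneg (m : ℝ)), mul_le_mul_of_nonneg_left hm
      (show (0 : ℝ) ≤ m by positivity), pow_succ (m : ℝ) 3, pow_succ (m : ℝ) 4]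

theorem factor_tail_le (m : ℕ) (L : List ℕ) (j : ℕ) : factor L j ≤ factor (m :: L) j := by
  rw [factor_cons]
  have : (0 : ℝ) ≤ j * m := by positivity
  nlinarith [mul_nonneg this (factor_nonneg L j)]

theorem abs_tsum_sub_le {f : ℕ → ℝ} {K q : ℝ} (hq0 : 0 ≤ q) (hq : q ≤ 1 / 2)
    (hf : ∀ i, |f (i + 2)| ≤ K * q ^ i) : |∑' j, f j - f 0 - f 1| ≤ 2 * K := by
  have hK : 0 ≤ K := by simpa using (abs_nonneg _).trans (hf 0)
  have h1 : HasSum (fun i => K * q ^ i) (K * (1 - q)⁻¹) :=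
    (hasSum_geometric_of_lt_one hq0 (by linarith)).mul_left K
  have h2 : Summable fun i => f (i + 2) := Summable.of_norm_bounded h1.summable hf
  have h3 := ((summable_nat_add_iff 2).1 h2).sum_add_tsum_nat_add 2
  have h4 : ∑' j, f j - f 0 - f 1 = ∑' i, f (i + 2) := by
    rw [← h3, Finset.sum_range_succ, Finset.sum_range_one]; ring
  rw [h4, ← Real.norm_eq_abs]
  refine (tsum_of_norm_bounded h1 hf).trans ?_
  rw [mul_comm 2 K]
  refine mul_le_mul_of_nonneg_left ?_ hK
  rw [inv_le_comm₀ (by linarith) two_pos]; linarith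

/-- Up to a small error, only the first two coefficients matter. -/
theorem abs_series_sub_le {b : ℕ → ℝ} {s B V u : ℝ} (hs : 0 < s)
    (hB : ∀ j, |b j| * s ^ j ≤ B) {L M : List ℕ} (hLM : ∀ j, factor L j ≤ factor M j)
    (hu : 0 ≤ u) (huV : u * factor M 1 ≤ V * s) (hV : V * ratio M ≤ 1 / 2) :
    |∑' j, factor L j * b j * u ^ j - b 0 - factor L 1 * b 1 * u| ≤
      2 * (B * V ^ 2 * ratio M) := by
  have hr := ratio_nonneg M
  have hf := factor_nonneg M 1
  have hV0 : 0 ≤ V := by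
    by_contra! h1
    have := mul_neg_of_neg_of_pos h1 hs
    linarith [mul_nonneg hu hf]
  have h0 : factor L 0 = 1 := by simp [factor]
  -- The terms from `j = 2` on are dominated by a geometric series of ratio `V * ratio M ≤ 1 / 2`.
  -- Bounding with `M` covers both the whole contest and its followers.
  have key := abs_tsum_sub_le (f := fun j => factor L j * b j * u ^ j)
    (K := B * V ^ 2 * ratio M) (mul_nonneg hV0 hr) hV fun i => by
    calc |factor L (i + 2) * b (i + 2) * u ^ (i + 2)|
        = factor L (i + 2) * |b (i + 2)| * u ^ (i + 2) := by
          rw [abs_mul, abs_mul, abs_of_nonneg (factor_nonneg _ _),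
            abs_of_nonneg (pow_nonneg hu _)]
      _ ≤ (factor M 1 ^ (i + 2) * ratio M ^ (i + 1)) * |b (i + 2)| * u ^ (i + 2) := by
          gcongr
          exact (hLM _).trans (factor_succ_le M (i + 1))
      _ = |b (i + 2)| * ratio M ^ (i + 1) * (u * factor M 1) ^ (i + 2) := by
          rw [mul_pow]; ring
      _ ≤ |b (i + 2)| * ratio M ^ (i + 1) * (V * s) ^ (i + 2) := by gcongr
      _ = (|b (i + 2)| * s ^ (i + 2)) * (ratio M ^ (i + 1) * V ^ (i + 2)) := by
          rw [mul_pow]; ring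
      _ ≤ B * (ratio M ^ (i + 1) * V ^ (i + 2)) := by
          gcongr; exact hB _
      _ = B * V ^ 2 * ratio M * (V * ratio M) ^ i := by rw [mul_pow]; ring
  simpa [h0] using key

theorem ratio_le_of {L : List ℕ} (hL : ∀ m ∈ L, 0 < m) {η : ℝ} (hη : 0 < η)
    (hn : 1 / η ^ 3 ≤ L.sum) : ratio L ≤ η := by
  have h1 := one_add_sum_le_factor L
  have h2 := ratio_pow_three_mul_le hL
  have h3 : 1 / η ^ 3 < factor L 1 := by linarith
  rw [div_lt_iff₀ (by positivity)] at h3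
  have h5 : 0 < factor L 1 := (by positivity : (0 : ℝ) < 1 + (L.sum : ℝ)).trans_le h1
  refine le_of_pow_le_pow_left₀ three_ne_zero hη.le ?_
  refine le_of_mul_le_mul_right ?_ h5
  linarith

/-- If `h` is analytic at the saturation point, then single leaders of large contests exert about
half of the saturation effort. -/
theorem leadEffort_near_half_of_analytic {n₀ : ℕ}
    (hS : ∀ n, n₀ ≤ n → StandingAssumptions h Xbar n)
    (ha : AnalyticWithinAt ℝ h (Icc 0 Xbar) Xbar) {ε : ℝ} (hε : 0 < ε) :
    ∃ N, ∀ n, N ≤ n → ∀ c : Composition n, IsSingleLeader c →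
      |leadEffort h Xbar c.blocks - Xbar / 2| ≤ ε := by
  have hXpos := (hS n₀ le_rfl).saturation_pos
  obtain ⟨b, ρ, hρ, hb, hb0, hb1, hev⟩ := exists_series (hS n₀ le_rfl) ha
  obtain ⟨X₀, hX₀, hser⟩ := exists_Ico_of_eventually hXpos hev
  obtain ⟨N₁, hN₁⟩ := eventually_root hS (P := fun X => X₀ < X)
    (nhdsWithin_le_nhds (lt_mem_nhds hX₀.2))
  set s := ρ / 2 with hs
  have hs0 : 0 < s := by positivity
  obtain ⟨B, hB0, hB⟩ := hb.exists_bound hs0.le (half_lt_self hρ)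
  -- At `u = W / P` the linear part `Xbar + P b_1 u` equals `-1`. An error of at most `1` keeps the
  -- response nonpositive, so the root lies above and there `P u ≤ W`.
  set W := (Xbar + 1) / (- b 1) with hW
  have hW0 : 0 < W := div_pos (by linarith) (by linarith)
  have hbW : b 1 * W = - (Xbar + 1) := by
    rw [hW, div_neg, mul_neg, mul_div_cancel₀ _ hb1.ne]
  set V := W / s with hV
  have hV0 : 0 < V := by positivity
  have hVs : V * s = W := by rw [hV]; field_simp
  set δ := min 1 (ε / 2) with hδ
  have hδ0 : 0 < δ := by positivity
  -- The first bound makes the geometric ratio at most `1 / 2`, the second makes the series error at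
  -- most `δ`.
  set η := min (1 / (2 * V)) (δ / (2 * (B * V ^ 2 + 1))) with hη
  have hη0 : 0 < η := by positivity
  have hh0 := h_pos (hS n₀ le_rfl) (X := (X₀ + Xbar) / 2) ⟨by linarith [hX₀.1], by linarith [hX₀.2]⟩
  set X₁ := (X₀ + Xbar) / 2 with hX₁
  have hX₁0 : X₀ < X₁ := by rw [hX₁]; linarith [hX₀.2]
  have hX₁1 : X₁ < Xbar := by rw [hX₁]; linarith [hX₀.2]
  obtain ⟨N₂, hN₂⟩ := exists_nat_ge (W / h X₁)
  obtain ⟨N₃, hN₃⟩ := exists_nat_ge (1 / η ^ 3)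
  refine ⟨max (max n₀ N₁) (max N₂ N₃), fun n hn c hc => ?_⟩
  simp only [max_le_iff] at hn
  obtain ⟨⟨hn0, hn1⟩, hn2, hn3⟩ := hn
  have hSn := hS n hn0
  have hT := isTail_blocks c
  have hroot := hN₁ n hn1 c
  have hsum := c.blocks_sum
  obtain ⟨L, hL⟩ := blocks_eq_one_cons hc
  rw [hL] at hT hroot hsum ⊢
  set M := 1 :: L with hM
  have hratio : ratio M ≤ η := ratio_le_of hT.1 hη0 (by
    rw [hsum]; exact hN₃.trans (by exact_mod_cast hn3))
  have hr0 := ratio_nonneg M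
  have hVr : V * ratio M ≤ 1 / 2 := by
    have h1 : ratio M ≤ 1 / (2 * V) := hratio.trans (min_le_left _ _)
    calc V * ratio M ≤ V * (1 / (2 * V)) := mul_le_mul_of_nonneg_left h1 hV0.le
      _ = 1 / 2 := by field_simp
  have hE : 2 * (B * V ^ 2 * ratio M) ≤ δ := by
    have h1 : ratio M ≤ δ / (2 * (B * V ^ 2 + 1)) := hratio.trans (min_le_right _ _)
    rw [le_div_iff₀ (by positivity)] at h1
    linarith
  have hP : (n : ℝ) < factor M 1 := by
    have := one_add_sum_le_factor M
    rw [hsum] at this; linarith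
  have hP0 : 0 < factor M 1 := (Nat.cast_nonneg n).trans_lt hP
  have hPL : factor M 1 = 2 * factor L 1 := by rw [hM, factor_cons]; push_cast; ring
  -- a total effort below the equilibrium one
  obtain ⟨X₂, hX₂, hX₂W⟩ : ∃ X₂ ∈ Icc X₁ Xbar, h X₂ = W / factor M 1 := by
    have hcont : ContinuousOn h (Icc X₁ Xbar) := fun X hX =>
      (hasDerivWithinAt_h hSn ⟨hX₀.1.trans (hX₁0.le.trans hX.1), hX.2⟩).continuousWithinAt.mono
        (Icc_subset_Icc (hX₀.1.trans hX₁0.le) le_rfl)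
    have h1 := intermediate_value_Icc' hX₁1.le hcont
    rw [hSn.saturation] at h1
    refine h1 ⟨by positivity, ?_⟩
    rw [div_le_iff₀ hP0, ← div_le_iff₀' hh0]
    have : (N₂ : ℝ) ≤ n := by exact_mod_cast hn2
    linarith
  have hX₂r : X₂ ≤ root h Xbar M := by
    refine le_root hSn hT hX₂.2 ?_
    rw [resp_eq_tsum hSn hX₀ hb hser hT ⟨hX₁0.trans_le hX₂.1, hX₂.2⟩]
    have h1 := abs_series_sub_le hs0 hB (L := M) (M := M) (fun _ => le_rfl) (u := h X₂) (V := V)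
      (by rw [hX₂W]; positivity) (by rw [hX₂W, hVs]; field_simp; exact le_rfl) hVr
    have h2 : factor M 1 * b 1 * h X₂ = - (Xbar + 1) := by
      rw [hX₂W, ← hbW]; field_simp
    rw [h2, hb0] at h1
    have h3 := (abs_le.1 h1).2
    have h4 : δ ≤ 1 := min_le_left _ _
    linarith
  have hrm := root_mem hSn hT
  set X := root h Xbar M with hX
  have hu : 0 ≤ h X := (h_pos hSn hrm).le
  have huV : h X * factor M 1 ≤ V * s := by
    rw [hVs, ← le_div_iff₀ hP0, ← hX₂W]
    exact (strictAntiOn_h hSn).antitoneOn ⟨hX₀.1.trans (hX₁0.le.trans hX₂.1), hX₂.2⟩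
      (Ico_subset_Icc_self hrm) hX₂r
  have hXI : X ∈ Ioc X₀ Xbar := ⟨hroot, hrm.2.le⟩
  -- Applied to the whole contest, where the response is `0`, and to the followers, where it is the
  -- leader's effort. Half the first estimate subtracted from the second leaves an error of `3δ/2 ≤
  -- ε`.
  have h1 := abs_series_sub_le hs0 hB (L := M) (M := M) (fun _ => le_rfl) hu huV hVr
  have h2 := abs_series_sub_le hs0 hB (L := L) (M := M) (factor_tail_le 1 L) hu huV hVr
  rw [← resp_eq_tsum hSn hX₀ hb hser hT hXI, resp_root hSn hT, hb0, hPL] at h1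
  rw [← resp_eq_tsum hSn hX₀ hb hser hT.of_cons hXI, ← leadEffort_eq_resp hSn hT, hb0] at h2
  have h3 : δ ≤ ε / 2 := min_le_right _ _
  rw [abs_le] at h1 h2 ⊢
  constructor <;> linarith

end Contest

theorem proposition3 (h : ℝ → ℝ) (Xbar : ℝ) :
    (∀ (n : ℕ) (hn : 0 < n), StandingAssumptions h Xbar n →
      -- every contest has a unique equilibrium effort profile; its maximum is player 1's effort
      (∀ c : Composition n, ∃! x, IsEquilibriumProfile h c x) ∧
      (∀ (c : Composition n) (x : Fin n → ℝ), IsEquilibriumProfile h c x → ∀ i, x i ≤ x ⟨0, hn⟩) ∧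
      -- the simultaneous contest is the minimizer
      (∀ c : Composition n, MinimizesHighestEffort h c ↔ c = Composition.single n hn) ∧
      -- maximizers have a single leader
      (∀ c : Composition n, MaximizesHighestEffort h c → IsSingleLeader c) ∧
      -- linear marginal benefit
      ((∃ a b : ℝ, ∀ X ∈ Set.Icc 0 Xbar, h X = a * X + b) →
        ∀ c : Composition n, IsSingleLeader c → MaximizesHighestEffort h c)) ∧
    -- large contests
    (∀ n₀ : ℕ, (∀ n, n₀ ≤ n → StandingAssumptions h Xbar n) →
      (∀ T : ℕ, ∀ ε : ℝ, 0 < ε → ∃ N : ℕ, ∀ n, N ≤ n → ∀ c c' : Composition n,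
        c.length ≤ T → c'.length ≤ T → IsSingleLeader c →
        ∀ m m' : ℝ, IsHighestEffort h c m → IsHighestEffort h c' m' → m' ≤ m + ε) ∧
      (AnalyticWithinAt ℝ h (Set.Icc 0 Xbar) Xbar →
        ∀ ε : ℝ, 0 < ε → ∃ N : ℕ, ∀ n, N ≤ n → ∀ c c' : Composition n, IsSingleLeader c →
        ∀ m m' : ℝ, IsHighestEffort h c m → IsHighestEffort h c' m' → m' ≤ m + ε)) := by
  refine ⟨fun n hn hS => ⟨fun c => ?_, fun c x hx i => ?_, Contest.minimizes_iff_single hS hn,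
    fun c => Contest.isSingleLeader_of_maximizes hS hn,
    fun hlin c => Contest.maximizes_of_linear hS hn hlin⟩,
    fun n₀ hS => ⟨fun T ε hε => ?_, fun ha ε hε => ?_⟩⟩
  · exact ⟨_, (Contest.isEquilibriumProfile_iff hS).2 rfl,
      fun x hx => (Contest.isEquilibriumProfile_iff hS).1 hx⟩
  · rw [(Contest.isEquilibriumProfile_iff hS).1 hx, Contest.profile_zero c hn]
    exact Contest.profile_le hS c i
  · obtain ⟨N, hN⟩ := Contest.leadEffort_near_half hS (T + 1) (half_pos hε)
    refine ⟨max N (max n₀ 1), fun n hn c c' hcT hcT' hc m m' hm hm' => ?_⟩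
    exact Contest.le_add_of_near_half (hS n (by omega)) (by omega) (hN n (by omega))
      hcT hcT' hc hm hm'
  · obtain ⟨N, hN⟩ := Contest.leadEffort_near_half_of_analytic hS ha (half_pos hε)
    refine ⟨max N (max n₀ 1), fun n hn c c' hc m m' hm hm' => ?_⟩
    -- No contest has more than `n` periods, so `T = n` imposes no restriction.
    exact Contest.le_add_of_near_half (T := n) (hS n (by omega)) (by omega)
      (fun c _ => hN n (by omega) c) c.length_le c'.length_le hc hm hm'
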